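/- Let $\mathbb U\subset\mathbb C$ be an open set conformally equivalent to the unit disc $\mathbb D$, let $\Sigma$ be a complex Banach space, and let $\mathscr F$ be an acceptable space of analytic functions $\mathbb U\to\Sigma$. That is, $\mathscr F$ is a Banach space of analytic functions $\mathbb U\to\Sigma$ such that: (a) all evaluations $\delta_z:\mathscr F\to\Sigma$ ($z\in\mathbb U$) are continuous; (b) $\mathscr F$ is a module under pointwise multiplication, with jointly continuous product, over the Fréchet algebra $A^\infty_{\mathbb U}$ of the functions $a(u)=\sum_{n\ge0}c_n\varphi(u)^n$, where $(c_n)$ is rapidly decreasing and $\varphi:\mathbb U\to\mathbb D$ is a conformal equivalence (the algebra does not depend on $\varphi$); (c) for each conformal equivalence $\varphi:\mathbb U\to\mathbb D$ there is a constant $K>0$ such that, for analytic $f:\mathbb U\to\Sigma$, $\varphi f\in\mathscr F$ if and only if $f\in\mathscr F$, and then $K^{-1}\|\varphi f\|\le\|f\|\le K\|\varphi f\|$. For a Banach space $\mathscr E$ of analytic functions on a domain, with values in a Banach space $V$ and with continuous evaluations, write $\tau_{(n,0]}f=(f^{(n-1)}/(n-1)!,\dots,f',f)$ and let $\mathscr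 E^{(n)}_z=\{\tau_{(n,0]}f(z):f\in\mathscr E\}\subset V^n$ be the $n$-th Rochberg space at $z$, with the quotient norm $\|x\|=\inf\{\|f\|_{\mathscr E}:\tau_{(n,0]}f(z)=x\}$ (so $\mathscr E^{(0)}_z=0$). Fix a conformal map $\psi:\mathbb D\to\mathbb U$ and put $\mathscr G=\{f\circ\psi:f\in\mathscr F\}$ with $\|f\circ\psi\|_{\mathscr G}=\|f\|_{\mathscr F}$. Define Banach spaces $\mathscr G^{(n)}$ of analytic functions $\mathbb D\to\Sigma^n$ by $\mathscr G^{(1)}=\mathscr G$ and $$\mathscr G^{(n+1)}=\Big\{(g_n,\dots,g_0):\ g_0\in\mathscr G,\ \big(g_n-\tfrac{g_0^{(n)}}{n!},\dots,g_1-g_0'\big)\in\mathscr G^{(n)}\Big\},$$ with norm the sum of the norms of these two elements. For $u=\psi(w)\in\mathbb U$ let $L(n,u):\Sigma^n\to\Sigma^n$ be the invertible triangular (Faà di Bruno) matrix that maps $\tau_{(n,0]}f(u)$ to $\tau_{(n,0]}(f\circ\psi)(w)$ for every $f$ analytic near $u$. Let $\mathscr T=\mathscr T_{m}$ be the space of analytic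 functions $H:\mathbb U\to\Sigma^m$ for which $w\mapsto L(m,\psi(w))H(\psi(w))$ belongs to $\mathscr G^{(m)}$, with the norm of the latter function; it satisfies $\mathscr T_u=\mathscr F^{(m)}_u$ for all $u\in\mathbb U$, with equivalent norms. For $m,n\ge1$ and $z\in\mathbb U$ put $F[m,n]=(\mathscr T_m)^{(n)}_z$, and write its elements as arrays $(x_{ij})_{0\le i<n,\,0\le j<m}$ in $\Sigma$. **Proposition.** For every $m\ge1$ and $z\in\mathbb U$, the formula $$E_{2,m}(x_m,\dots,x_0)=\Big(\tfrac{(i+j)!}{i!\,j!}\,x_{i+j}\Big)_{0\le i<m,\ 0\le j<2}$$ defines a bounded operator $E_{2,m}:\mathscr F^{(m+1)}_z\to F[2,m]$ which is an isomorphic embedding with complemented range, and the quotient $F[2,m]/E_{2,m}[\mathscr F^{(m+1)}_z]$ is isomorphic to $\mathscr F^{(m-1)}_z$. Moreover, $F[2,m]$ is isomorphic to $F[m,2]$. (Here $F[2,m]$ and $F[m,2]$ may be formed with different conformal maps $\psi$.) -/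

import Mathlib

open TopologicalSpace Filter Topology

noncomputable section

namespace Rochberg

/-! ### Analytic functions on an open subset of the plane -/

section Hol

variable {W U : Opens ℂ} {V : Type*} [NormedAddCommGroup V] [NormedSpace ℂ V]

/-- Extension by zero of a function on `U` (only its values and derivatives on `U` are used). -/
def ext {V : Type*} [NormedAddCommGroup V] (f : U → V) : ℂ → V := Function.extend Subtype.val f 0

theorem ext_apply {V : Type*} [NormedAddCommGroup V] (f : U → V) (u : U) : ext f u = f u :=
  Subtype.val_injective.extend_apply f 0 u

theorem ext_eventuallyEq {V : Type*} [NormedAddCommGroup V] (g : ℂ → V) (u : U) : ext (fun w : U => g w) =ᶠ[𝓝 (u : ℂ)] g := by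
  filter_upwards [U.isOpen.mem_nhds u.2] with w hw
  exact ext_apply (fun w : U => g w) ⟨w, hw⟩

/-- `f : U → V` is analytic. -/
def IsAnalytic (f : U → V) : Prop := ∀ u : U, AnalyticAt ℂ (ext f) u

theorem IsAnalytic.of_eq {f : U → V} (g : ℂ → V) (hg : ∀ u : U, AnalyticAt ℂ g u)
    (h : ∀ u : U, f u = g u) : IsAnalytic f := by
  obtain rfl : f = fun u : U => g u := funext h
  exact fun u => (hg u).congr (ext_eventuallyEq g u).symm

variable (U V) in
/-- The space of all analytic functions `U → V`. -/
def Hol : Submodule ℂ (U → V) where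
  carrier := {f | IsAnalytic f}
  zero_mem' := IsAnalytic.of_eq 0 (fun _ => analyticAt_const) (fun _ => rfl)
  add_mem' {f g} hf hg := IsAnalytic.of_eq (ext f + ext g) (fun u => (hf u).add (hg u))
    (fun u => by simp [ext_apply])
  smul_mem' c f hf := IsAnalytic.of_eq (c • ext f) (fun u => (hf u).const_smul)
    (fun u => by simp [ext_apply])

/-- The pointwise product of a scalar analytic function and a vector valued one. -/
def Hol.mul (a : Hol U ℂ) (f : Hol U V) : Hol U V :=
  ⟨fun u => a.1 u • f.1 u, IsAnalytic.of_eq (fun w => ext a.1 w • ext f.1 w)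
    (fun u => (a.2 u).smul (f.2 u)) (fun u => by simp [ext_apply])⟩

theorem Hol.mul_add (a : Hol U ℂ) (f g : Hol U V) :
    Hol.mul a (f + g) = Hol.mul a f + Hol.mul a g := by
  ext u; exact smul_add _ _ _

theorem Hol.mul_smul (a : Hol U ℂ) (c : ℂ) (f : Hol U V) :
    Hol.mul a (c • f) = c • Hol.mul a f := by
  ext u; exact smul_comm _ _ _

/-- Differentiation of analytic functions. -/
def Hol.D [CompleteSpace V] : Hol U V →ₗ[ℂ] Hol U V where
  toFun f := ⟨fun u => deriv (ext f.1) u,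
    IsAnalytic.of_eq (deriv (ext f.1)) (fun u => (f.2 u).deriv) (fun _ => rfl)⟩
  map_add' f g := by
    ext u
    have h : ext (f + g).1 =ᶠ[𝓝 (u : ℂ)] ext f.1 + ext g.1 := by
      refine EventuallyEq.trans (EventuallyEq.of_eq ?_) (ext_eventuallyEq (ext f.1 + ext g.1) u)
      congr 1; funext w; simp [ext_apply]
    change deriv (ext (f + g).1) u = deriv (ext f.1) u + deriv (ext g.1) u
    rw [h.deriv_eq, deriv_add (f.2 u).differentiableAt (g.2 u).differentiableAt]
  map_smul' c f := by
    ext u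
    have h : ext (c • f).1 =ᶠ[𝓝 (u : ℂ)] c • ext f.1 := by
      refine EventuallyEq.trans (EventuallyEq.of_eq ?_) (ext_eventuallyEq (c • ext f.1) u)
      congr 1; funext w; simp [ext_apply]
    change deriv (ext (c • f).1) u = c • deriv (ext f.1) u
    rw [h.deriv_eq, deriv_const_smul _ (f.2 u).differentiableAt]

/-- `τ_k f = f^(k) / k!`, as an analytic function. -/
def Hol.taylor [CompleteSpace V] (k : ℕ) : Hol U V →ₗ[ℂ] Hol U V :=
  ((k.factorial : ℂ)⁻¹) • (Hol.D : Hol U V →ₗ[ℂ] Hol U V) ^ k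

/-- The `i`-th component of an analytic function with values in `V ^ n`. -/
def Hol.comp {n : ℕ} (i : Fin n) : Hol U (Fin n → V) →ₗ[ℂ] Hol U V where
  toFun f := ⟨fun u => f.1 u i, IsAnalytic.of_eq (fun w => ext f.1 w i)
    (fun u => analyticAt_pi_iff.1 (f.2 u) i) (fun u => by simp [ext_apply])⟩
  map_add' _ _ := rfl
  map_smul' _ _ := rfl

/-- The analytic function with values in `V ^ n` with prescribed components. -/
def Hol.tuple {n : ℕ} : (Fin n → Hol U V) →ₗ[ℂ] Hol U (Fin n → V) where
  toFun f := ⟨fun u i => (f i).1 u, IsAnalytic.of_eq (fun w i => ext (f i).1 w)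
    (fun u => AnalyticAt.pi fun i => (f i).2 u) (fun u => by funext i; simp [ext_apply])⟩
  map_add' _ _ := rfl
  map_smul' _ _ := rfl

variable (W U) in
/-- A conformal equivalence: an analytic bijection with analytic inverse. -/
structure ConformalEquiv extends W ≃ U where
  analytic : IsAnalytic fun w : W => ((toEquiv w : U) : ℂ)
  analytic_symm : IsAnalytic fun u : U => ((toEquiv.symm u : W) : ℂ)

/-- The inverse conformal equivalence. -/
def ConformalEquiv.symm (e : ConformalEquiv W U) : ConformalEquiv U W where
  toEquiv := e.toEquiv.symm
  analytic := e.analytic_symm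
  analytic_symm := e.analytic

/-- A conformal equivalence as a scalar analytic function. -/
def ConformalEquiv.hol (e : ConformalEquiv W U) : Hol W ℂ :=
  ⟨fun w : W => ((e.toEquiv w : U) : ℂ), e.analytic⟩

/-- Composition `f ↦ f ∘ e` with a conformal equivalence. -/
def ConformalEquiv.pull (e : ConformalEquiv W U) : Hol U V →ₗ[ℂ] Hol W V where
  toFun f := ⟨fun w => f.1 (e.toEquiv w), IsAnalytic.of_eq (fun w => ext f.1 (ext e.hol.1 w))
    (fun w => by
      refine AnalyticAt.fun_comp ?_ (e.hol.2 w)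
      rw [ext_apply]
      exact f.2 (e.toEquiv w))
    (fun w => by
      rw [ext_apply]
      exact (ext_apply f.1 (e.toEquiv w)).symm)⟩
  map_add' _ _ := rfl
  map_smul' _ _ := rfl

end Hol

/-- The open unit disc. -/
def disc : Opens ℂ := ⟨Metric.ball 0 1, Metric.isOpen_ball⟩

/-! ### The range of an operator with the quotient norm -/

section QuotientRange

variable {E Y : Type*} [SeminormedAddCommGroup E] [NormedSpace ℂ E] [AddCommGroup Y] [Module ℂ Y]

/-- The range of a linear map `T : E → Y`, with the quotient norm of `E / ker T`. -/
def QuotientRange (T : E →ₗ[ℂ] Y) : Type _ := LinearMap.range T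

instance (T : E →ₗ[ℂ] Y) : SeminormedAddCommGroup (QuotientRange T) :=
  SeminormedAddCommGroup.induced (LinearMap.range T) _ T.quotKerEquivRange.symm

instance (T : E →ₗ[ℂ] Y) : NormedSpace ℂ (QuotientRange T) :=
  NormedSpace.induced ℂ (LinearMap.range T) _ T.quotKerEquivRange.symm.toLinearMap

/-- The inclusion of the range of `T` in `Y`. -/
def QuotientRange.val {T : E →ₗ[ℂ] Y} : QuotientRange T →ₗ[ℂ] Y :=
  (LinearMap.range T).subtype

/-- `T` as a map onto its range. -/
def QuotientRange.mk (T : E →ₗ[ℂ] Y) : E →ₗ[ℂ] QuotientRange T := T.rangeRestrict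

theorem QuotientRange.val_injective {T : E →ₗ[ℂ] Y} :
    Function.Injective (QuotientRange.val : QuotientRange T →ₗ[ℂ] Y) :=
  Subtype.val_injective

theorem QuotientRange.val_mk (T : E →ₗ[ℂ] Y) (f : E) : (QuotientRange.mk T f).val = T f := rfl

theorem QuotientRange.mk_surjective (T : E →ₗ[ℂ] Y) : Function.Surjective (QuotientRange.mk T) :=
  T.surjective_rangeRestrict

theorem QuotientRange.norm_mk (T : E →ₗ[ℂ] Y) (f : E) :
    ‖QuotientRange.mk T f‖ = ‖(Submodule.Quotient.mk f : E ⧸ LinearMap.ker T)‖ := by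
  have h : T.quotKerEquivRange.symm (T.rangeRestrict f) = Submodule.Quotient.mk f :=
    (LinearEquiv.symm_apply_eq T.quotKerEquivRange).2 rfl
  rw [← h]
  rfl

/-- The norm of `x` is the infimum of the norms of the `f` with `T f = x`. -/
theorem QuotientRange.norm_eq {T : E →ₗ[ℂ] Y} (x : QuotientRange T) :
    ‖x‖ = sInf {r : ℝ | ∃ f : E, T f = x.val ∧ r = ‖f‖} := by
  obtain ⟨f, rfl⟩ := QuotientRange.mk_surjective T x
  have hg : ∀ g : E, (Submodule.Quotient.mk g : E ⧸ LinearMap.ker T) =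
      Submodule.Quotient.mk f ↔ T g = T f := fun g => by
    rw [Submodule.Quotient.eq, LinearMap.mem_ker, map_sub, sub_eq_zero]
  rw [QuotientRange.norm_mk, QuotientRange.val_mk]
  refine (IsGLB.csInf_eq (s := {r : ℝ | ∃ g : E, T g = T f ∧ r = ‖g‖})
    (And.intro ?_ ?_) ⟨‖f‖, f, rfl, rfl⟩).symm
  · rintro r ⟨g, hgf, rfl⟩
    rw [← (hg g).2 hgf]
    exact Submodule.Quotient.norm_mk_le _ g
  · intro b hb
    refine le_of_forall_pos_lt_add fun ε hε => ?_
    obtain ⟨g, hgf, hlt⟩ := Submodule.Quotient.norm_mk_lt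
      (Submodule.Quotient.mk f : E ⧸ LinearMap.ker T) hε
    exact (hb ⟨g, (hg g).1 hgf, rfl⟩).trans_lt hlt

end QuotientRange

/-! ### Normed spaces of analytic functions -/

/-- A linear space of analytic functions `U → V` carrying a seminorm of its own. Completeness and
definiteness are part of `FunSpace.IsBanach`. -/
structure FunSpace (U : Opens ℂ) (V : Type*) [NormedAddCommGroup V] [NormedSpace ℂ V] where
  carrier : Submodule ℂ (Hol U V)
  nrm : Seminorm ℂ carrier

section FunSpace

variable {U W : Opens ℂ} {V : Type*} [NormedAddCommGroup V] [NormedSpace ℂ V]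

/-- The elements of a space of analytic functions, topologised by the norm of that space. -/
def FunSpace.Elem (F : FunSpace U V) : Type _ := F.carrier

instance (F : FunSpace U V) : SeminormedAddCommGroup F.Elem :=
  AddGroupSeminorm.toSeminormedAddCommGroup (E := F.carrier) F.nrm.toAddGroupSeminorm
instance (F : FunSpace U V) : NormedSpace ℂ F.Elem where
  __ := (inferInstance : Module ℂ F.carrier)
  norm_smul_le c f := (map_smul_eq_mul F.nrm c f).le

/-- `F` is a Banach space. -/
def FunSpace.IsBanach (F : FunSpace U V) : Prop :=
  (∀ f : F.Elem, ‖f‖ = 0 → f = 0) ∧ CompleteSpace F.Elem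

/-- A rapidly decreasing sequence of complex numbers. -/
def RapidlyDecreasing (c : ℕ → ℂ) : Prop :=
  ∀ N : ℕ, BddAbove (Set.range fun n : ℕ => ((n : ℝ) + 1) ^ N * ‖c n‖)

/-- The `N`-th norm of the Fréchet space of rapidly decreasing sequences. -/
def rapidNorm (N : ℕ) (c : ℕ → ℂ) : ℝ := ⨆ n : ℕ, ((n : ℝ) + 1) ^ N * ‖c n‖

/-- `a` belongs to the algebra `φ^*[A^∞]` of the functions `a = b ∘ φ`, where `b` is analytic on
the disc with rapidly decreasing Taylor coefficients `c` at the origin. -/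
def HasRapidExpansion (φ : ConformalEquiv U disc) (c : ℕ → ℂ) (a : Hol U ℂ) : Prop :=
  RapidlyDecreasing c ∧ ∀ u : U, HasSum (fun n => c n * φ.hol.1 u ^ n) (a.1 u)

/-- Acceptable spaces of analytic functions. In `module`, the Fréchet algebra `A^∞_U` is realised
as `φ^*[A^∞]` for some conformal equivalence `φ` (as a topological algebra it does not depend on
the choice), and joint continuity of the bilinear product `A^∞_U × F → F` is expressed through
the increasing sequence of norms that defines the topology of `A^∞_U`. -/
structure FunSpace.IsAcceptable (F : FunSpace U V) : Prop where
  banach : F.IsBanach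
  eval : ∀ z : U, ∃ C : ℝ, ∀ f : F.carrier, ‖f.1.1 z‖ ≤ C * F.nrm f
  module : ∃ φ : ConformalEquiv U disc, ∃ (N : ℕ) (C : ℝ), ∀ (a : Hol U ℂ) (c : ℕ → ℂ),
    HasRapidExpansion φ c a → ∀ f : F.carrier, ∃ h : Hol.mul a f.1 ∈ F.carrier,
      F.nrm ⟨Hol.mul a f.1, h⟩ ≤ C * rapidNorm N c * F.nrm f
  divide : ∀ φ : ConformalEquiv U disc, ∃ K : ℝ, 0 < K ∧ ∀ f : Hol U V,
    (Hol.mul φ.hol f ∈ F.carrier ↔ f ∈ F.carrier) ∧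
    ∀ (h : f ∈ F.carrier) (h' : Hol.mul φ.hol f ∈ F.carrier),
      K⁻¹ * F.nrm ⟨Hol.mul φ.hol f, h'⟩ ≤ F.nrm ⟨f, h⟩ ∧
      F.nrm ⟨f, h⟩ ≤ K * F.nrm ⟨Hol.mul φ.hol f, h'⟩

/-- The space of those `f` with `L f ∈ F`, normed by `‖f‖ = ‖L f‖_F`. -/
def FunSpace.comap {V' : Type*} [NormedAddCommGroup V'] [NormedSpace ℂ V'] (F : FunSpace U V)
    (L : Hol W V' →ₗ[ℂ] Hol U V) : FunSpace W V' where
  carrier := F.carrier.comap L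
  nrm := F.nrm.comp (L.restrict (p := F.carrier.comap L) (q := F.carrier) fun _ h => h)

/-- `ψ^*[F] = {f ∘ ψ : f ∈ F}`, with the norm of `f`. -/
def FunSpace.pullback (F : FunSpace U V) (ψ : ConformalEquiv W U) : FunSpace W V :=
  F.comap ψ.symm.pull

/-! ### Rochberg spaces

An array `(x_{n-1}, …, x_0)` is written as the function `i ↦ x_i` on `Fin n`. -/

variable [CompleteSpace V]

/-- `f ↦ τ_{(n,0]} f (z)`. -/
def FunSpace.jet (F : FunSpace U V) (z : U) (n : ℕ) : F.Elem →ₗ[ℂ] (Fin n → V) where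
  toFun f i := (Hol.taylor (i : ℕ) (Subtype.val f : Hol U V)).1 z
  map_add' f g := by
    funext i
    change (Hol.taylor (i : ℕ) ((Subtype.val f : Hol U V) + (Subtype.val g : Hol U V))).1 z = _
    rw [map_add]; rfl
  map_smul' c f := by
    funext i
    change (Hol.taylor (i : ℕ) (c • (Subtype.val f : Hol U V))).1 z = _
    rw [map_smul]; rfl

/-- The Rochberg space `F^(n)_z`, the linear subspace of `V ^ n` of all `τ_{(n,0]} f (z)` with
`f ∈ F`, with the quotient norm. -/
abbrev FunSpace.RochbergSpace (F : FunSpace U V) (z : U) (n : ℕ) : Type _ :=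
  QuotientRange (F.jet z n)

/-! ### The derived spaces of analytic functions -/

/-- `(f_n, …, f_0) ↦ (f_n, …, f_1) - τ_{[n,1]} f_0`. -/
def twist {n : ℕ} : Hol U (Fin (n + 1) → V) →ₗ[ℂ] Hol U (Fin n → V) :=
  Hol.tuple ∘ₗ LinearMap.pi fun i : Fin n =>
    Hol.comp i.succ - Hol.taylor ((i : ℕ) + 1) ∘ₗ Hol.comp 0

/-- `G ⊕ F` twisted by `τ_{[n,1]}`: the space of the `(f_n, …, f_0)` with `f_0 ∈ F` and
`(f_n, …, f_1) - τ_{[n,1]} f_0 ∈ G`, normed by the sum of the norms of these two. -/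
def FunSpace.twistedSum {n : ℕ} (G : FunSpace U (Fin n → V)) (F : FunSpace U V) :
    FunSpace U (Fin (n + 1) → V) :=
  let X : Submodule ℂ (Hol U (Fin (n + 1) → V)) :=
    G.carrier.comap (twist (U := U) (V := V)) ⊓
      F.carrier.comap (Hol.comp (U := U) (V := V) (0 : Fin (n + 1)))
  let p : X →ₗ[ℂ] G.carrier := (twist (U := U) (V := V)).restrict
    (p := X) (q := G.carrier) fun _ h => (Submodule.mem_inf.1 h).1
  let q : X →ₗ[ℂ] F.carrier := (Hol.comp (U := U) (V := V) (0 : Fin (n + 1))).restrict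
    (p := X) (q := F.carrier) fun _ h => (Submodule.mem_inf.1 h).2
  { carrier := X
    nrm := G.nrm.comp p + F.nrm.comp q }

/-- The spaces `F^(n)` of `V ^ n`-valued functions. The induction starts with the trivial space
`F^(0)`, so that `F^(1) = F`. -/
def FunSpace.derived (F : FunSpace U V) : (n : ℕ) → FunSpace U (Fin n → V)
  | 0 => ⟨⊤, 0⟩
  | n + 1 => (F.derived n).twistedSum F

/-- Faà di Bruno coefficients of a conformal equivalence `ψ` at `z`: the `m`-th Taylor coefficient
at `z` of `w ↦ (ψ w - ψ z) ^ k`, that is, the coefficient of `t ^ m` in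
`(∑_{j ≥ 1} (ψ^(j)(z) / j!) t ^ j) ^ k`. -/
def fdb (ψ : ConformalEquiv W U) (m k : ℕ) (z : W) : ℂ :=
  PowerSeries.coeff m
    ((PowerSeries.mk fun j => if j = 0 then 0 else (Hol.taylor j ψ.hol).1 z) ^ k)

theorem fdb_analytic (ψ : ConformalEquiv W U) (m k : ℕ) : IsAnalytic (fdb ψ m k) := by
  induction k generalizing m with
  | zero =>
    exact IsAnalytic.of_eq (fun _ => PowerSeries.coeff m 1) (fun _ => analyticAt_const)
      (fun z => by simp [fdb])
  | succ k ih =>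
    refine IsAnalytic.of_eq (fun w => ∑ p ∈ Finset.HasAntidiagonal.antidiagonal m, ext (fdb ψ p.1 k) w *
      (if p.2 = 0 then 0 else ext (Hol.taylor p.2 ψ.hol).1 w)) (fun u => ?_) (fun u => ?_)
    · refine Finset.analyticAt_fun_sum _ fun p _ => (ih p.1 u).mul ?_
      split_ifs
      · exact analyticAt_const
      · exact (Hol.taylor p.2 ψ.hol).2 u
    · simp [fdb, pow_succ, PowerSeries.coeff_mul, ext_apply]

/-- `H ↦ G`, where `G(z) = L(n, ψ z) (H(ψ z))` and `L(n, ψ z)` is the Faà di Bruno matrix, which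
sends the Taylor coefficients `(x_{n-1}, …, x_0)` of a function `f` at `ψ z` to those of `f ∘ ψ`
at `z`, namely `y_m = ∑_k (fdb ψ m k z) x_k`. -/
def chain (ψ : ConformalEquiv W U) (n : ℕ) : Hol U (Fin n → V) →ₗ[ℂ] Hol W (Fin n → V) where
  toFun H := Hol.tuple fun m => ∑ k : Fin n,
    Hol.mul ⟨fdb ψ m k, fdb_analytic ψ m k⟩ (Hol.comp k (ψ.pull H))
  map_add' H H' := by
    rw [← map_add, map_add]
    congr 1
    funext m
    simp only [map_add, Hol.mul_add, Finset.sum_add_distrib, Pi.add_apply]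
  map_smul' c H := by
    rw [RingHom.id_apply, ← map_smul, map_smul]
    congr 1
    funext m
    simp only [map_smul, Hol.mul_smul, Finset.smul_sum, Pi.smul_apply]

/-- The space `T` of `V ^ n`-valued analytic functions on `U` attached to `F` and to a conformal
map `ψ : 𝔻 → U`: if `G = ψ^*[F]`, then `T` consists of the functions `H` such that
`z ↦ L(n, ψ z) (H(ψ z))` belongs to `G^(n)`, with the norm of the latter function. -/
def FunSpace.derivedOn (F : FunSpace U V) (ψ : ConformalEquiv disc U) (n : ℕ) :
    FunSpace U (Fin n → V) :=
  ((F.pullback ψ).derived n).comap (chain ψ n)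

/-- `F[m,n]`, the `n`-th Rochberg space at `z` of the space `T` whose analytic family is
`(F^(m)_u)_u`. Its elements are arrays `(x_{ij})` with `i < n`, `j < m`. -/
abbrev FunSpace.Iterated (F : FunSpace U V) (ψ : ConformalEquiv disc U) (z : U) (m n : ℕ) :
    Type _ :=
  (F.derivedOn ψ m).RochbergSpace z n

end FunSpace

/-- `(x_{m+n-2}, …, x_0) ↦ ((i+j)! / (i! j!) x_{i+j})_{i < n, j < m}`; here `k = m + n - 1`. -/
def matrixE {V : Type*} [AddCommGroup V] [Module ℂ V] (m n k : ℕ) (hk : m + n = k + 1)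
    (x : Fin k → V) : Fin n → Fin m → V :=
  fun i j => (((i + j : ℕ).factorial : ℂ) / ((i : ℕ).factorial * (j : ℕ).factorial)) •
    x ⟨i + j, by omega⟩

end Rochberg

end

open TopologicalSpace Filter Topology

noncomputable section

namespace Rochberg

/-! ### Taylor coefficients of analytic functions -/

section Taylor

variable {W U : Opens ℂ} {V : Type*} [NormedAddCommGroup V] [NormedSpace ℂ V]

/-! Transport everything to the disc by `ψ`, with `w` the preimage of `z` and `t` the coordinate
minus `w`. Unwinding the recursion for the derived spaces shows that `𝒯_m` is a copy of the power
`F^m`: the tuple `(a_l)` corresponds to the function with components `g_k = ∑_{l ≤ k} τ_{k-l} a_l`,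
and its norm is the sum of the norms of the `a_l` (`FunSpace.exists_equiv_derivedOn`). A Rochberg
space is a quotient by the kernel of a jet map, so only two such kernels have to be compared.

For `F[m,2]`, put `p = ∑ t^l a_l` and `q = ∑ l t^l a_l`. The Taylor coefficients satisfy `g_k(w) =
p_k` and `g_k'(w) = (k+1) p_{k+1} - q_{k+1}`. For `F[2,m]` the same system arises from `p = a_0` and
`q = -t a_1`, because `g_0 = a_0` and `g_1 = a_0' + a_1`. In both cases these quantities vanish for
all `k < m` exactly when `p - q/m` vanishes to order `m+1` and `q/t` vanishes to order `m-1`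
(`elimination`). Up to a sign of `q/t`, the maps `P = p - q/m` and `Q = q/t` are bounded operators
on `F^m` and `F^2`, since acceptability bounds multiplication by `t`.

Together with right inverses, `P` and `Q` split both spaces as `F^{(m+1)}_z × F^{(m-1)}_z`
(`QuotientRange.exists_equiv_prod`), which gives the isomorphism. In `F[2,m]` the first summand
comes from the pairs `(f, 0)`, that is, from the functions `(f', f)`. Their jets are given by
`E_{2,m}` since `τ_i τ_j` is a binomial multiple of `τ_{i+j}`. -/

theorem Hol.add_val (f g : Hol U V) (u : U) : (f + g).1 u = f.1 u + g.1 u := rfl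

theorem Hol.smul_val (c : ℂ) (f : Hol U V) (u : U) : (c • f).1 u = c • f.1 u := rfl

/-- Evaluation of analytic functions at a point. -/
def Hol.eval (u : U) : Hol U V →ₗ[ℂ] V where
  toFun f := f.1 u
  map_add' _ _ := rfl
  map_smul' _ _ := rfl

theorem Hol.sum_val {ι : Type*} (s : Finset ι) (f : ι → Hol U V) (u : U) :
    (∑ i ∈ s, f i).1 u = ∑ i ∈ s, (f i).1 u :=
  map_sum (Hol.eval u) f s

theorem Hol.comp_val {n : ℕ} (i : Fin n) (f : Hol U (Fin n → V)) (u : U) :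
    (Hol.comp i f).1 u = f.1 u i := rfl

theorem Hol.tuple_val {n : ℕ} (f : Fin n → Hol U V) (u : U) (i : Fin n) :
    (Hol.tuple f).1 u i = (f i).1 u := rfl

theorem Hol.comp_tuple {n : ℕ} (f : Fin n → Hol U V) (i : Fin n) :
    Hol.comp i (Hol.tuple f) = f i := rfl

theorem Hol.ext_comp {n : ℕ} {f g : Hol U (Fin n → V)}
    (h : ∀ i, Hol.comp i f = Hol.comp i g) : f = g := by
  ext u i
  exact congrArg (fun k : Hol U V => k.1 u) (h i)

/-- A constant function. -/
def Hol.const (v : V) : Hol U V :=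
  ⟨fun _ => v, IsAnalytic.of_eq (fun _ => v) (fun _ => analyticAt_const) (fun _ => rfl)⟩

/-- The function `u ↦ u - c`. -/
def Hol.coord (c : ℂ) : Hol U ℂ :=
  ⟨fun u => (u : ℂ) - c, IsAnalytic.of_eq (fun u => u - c)
    (fun _ => analyticAt_id.sub analyticAt_const) (fun _ => rfl)⟩

theorem Hol.smul_mul (c : ℂ) (a : Hol U ℂ) (f : Hol U V) :
    Hol.mul (c • a) f = c • Hol.mul a f := by
  ext u; exact smul_assoc c (a.1 u) (f.1 u)

variable [CompleteSpace V]

theorem Hol.D_val_of_eq {f : Hol U V} (g : ℂ → V) (h : ∀ u : U, f.1 u = g u) (u : U) :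
    (Hol.D f).1 u = deriv g u := by
  have hf : f.1 = fun u : U => g u := funext h
  change deriv (ext f.1) u = _
  rw [hf]
  exact (ext_eventuallyEq g u).deriv_eq

theorem Hol.D_const (v : V) : Hol.D (Hol.const v : Hol U V) = 0 := by
  ext u
  rw [Hol.D_val_of_eq (fun _ => v) (fun _ => rfl)]
  simp

theorem Hol.D_coord (c : ℂ) : Hol.D (Hol.coord c : Hol U ℂ) = Hol.const 1 := by
  ext u
  rw [Hol.D_val_of_eq (fun u => u - c) (fun _ => rfl)]
  simp [Hol.const]

theorem Hol.D_mul (a : Hol U ℂ) (f : Hol U V) :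
    Hol.D (Hol.mul a f) = Hol.mul (Hol.D a) f + Hol.mul a (Hol.D f) := by
  ext u
  rw [Hol.D_val_of_eq (fun w => ext a.1 w • ext f.1 w)
    (fun u => by rw [ext_apply, ext_apply]; rfl)]
  have h := ((a.2 u).differentiableAt.hasDerivAt.fun_smul
    (f.2 u).differentiableAt.hasDerivAt).deriv
  rw [h, ext_apply, ext_apply, add_comm]
  rfl

theorem Hol.D_comp {n : ℕ} (i : Fin n) (f : Hol U (Fin n → V)) :
    Hol.D (Hol.comp i f) = Hol.comp i (Hol.D f) := by
  ext u
  rw [Hol.D_val_of_eq (fun w => ext f.1 w i) (fun u => by rw [ext_apply]; rfl)]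
  exact (hasDerivAt_pi.1 (f.2 u).differentiableAt.hasDerivAt i).deriv

theorem Hol.taylor_zero (f : Hol U V) : Hol.taylor 0 f = f := by
  simp [Hol.taylor]

theorem Hol.taylor_succ (k : ℕ) (f : Hol U V) :
    ((k : ℂ) + 1) • Hol.taylor (k + 1) f = Hol.D (Hol.taylor k f) := by
  have h : (k : ℂ) + 1 ≠ 0 := Nat.cast_add_one_ne_zero k
  simp only [Hol.taylor, LinearMap.smul_apply, map_smul, pow_succ', Module.End.mul_apply,
    smul_smul]
  congr 1
  rw [Nat.factorial_succ]
  push_cast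
  field_simp

theorem Hol.taylor_taylor (i j : ℕ) (f : Hol U V) :
    Hol.taylor i (Hol.taylor j f) =
      (((i + j).factorial : ℂ) / (i.factorial * j.factorial)) • Hol.taylor (i + j) f := by
  simp only [Hol.taylor, LinearMap.smul_apply, map_smul, pow_add, Module.End.mul_apply, smul_smul]
  congr 1
  have := Nat.cast_ne_zero (R := ℂ).2 (Nat.factorial_ne_zero (i + j))
  field_simp

theorem Hol.taylor_comp {n : ℕ} (k : ℕ) (i : Fin n) (f : Hol U (Fin n → V)) :
    Hol.taylor k (Hol.comp i f) = Hol.comp i (Hol.taylor k f) := by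
  have h : ∀ k : ℕ, (Hol.D ^ k) (Hol.comp i f) = Hol.comp i ((Hol.D ^ k) f) := fun k => by
    induction k with
    | zero => rfl
    | succ k ih => rw [pow_succ', pow_succ', Module.End.mul_apply, Module.End.mul_apply, ih,
        Hol.D_comp]
  simp only [Hol.taylor, LinearMap.smul_apply, map_smul, h]

theorem Hol.taylor_const (k : ℕ) (v : V) :
    Hol.taylor (k + 1) (Hol.const v : Hol U V) = 0 := by
  simp [Hol.taylor, pow_succ, Hol.D_const]

/-- The Leibniz rule. -/
theorem Hol.taylor_mul (n : ℕ) (a : Hol U ℂ) (f : Hol U V) :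
    Hol.taylor n (Hol.mul a f) = ∑ p ∈ Finset.HasAntidiagonal.antidiagonal n,
      Hol.mul (Hol.taylor p.1 a) (Hol.taylor p.2 f) := by
  induction n with
  | zero => simp [Hol.taylor_zero]
  | succ n ih =>
    have hn : (n : ℂ) + 1 ≠ 0 := Nat.cast_add_one_ne_zero n
    refine smul_right_injective _ hn ?_
    change ((n : ℂ) + 1) • _ = ((n : ℂ) + 1) • _
    -- Since `D τ_n = (n+1) τ_{n+1}`, the identity is proved after multiplication by `n+1`, which is
    -- split as `q.1 + q.2` so that each half matches one term of the product rule.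
    have hq : ∀ q ∈ Finset.HasAntidiagonal.antidiagonal (n + 1),
        ((n : ℂ) + 1) • Hol.mul (Hol.taylor q.1 a) (Hol.taylor q.2 f) =
          (q.1 : ℂ) • Hol.mul (Hol.taylor q.1 a) (Hol.taylor q.2 f) +
          (q.2 : ℂ) • Hol.mul (Hol.taylor q.1 a) (Hol.taylor q.2 f) := fun q hq => by
      rw [← add_smul]
      congr 1
      exact_mod_cast (Finset.HasAntidiagonal.mem_antidiagonal.1 hq).symm
    rw [Hol.taylor_succ, ih, map_sum, Finset.smul_sum, Finset.sum_congr rfl hq,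
      Finset.sum_add_distrib, Finset.Nat.sum_antidiagonal_succ,
      Finset.Nat.sum_antidiagonal_succ' (f := fun q : ℕ × ℕ =>
        (q.2 : ℂ) • Hol.mul (Hol.taylor q.1 a) (Hol.taylor q.2 f))]
    simp only [Nat.cast_zero, zero_smul, zero_add, ← Finset.sum_add_distrib]
    refine Finset.sum_congr rfl fun p _ => ?_
    rw [Hol.D_mul, ← Hol.taylor_succ, ← Hol.taylor_succ, Hol.smul_mul, Hol.mul_smul]
    push_cast
    rfl

theorem Hol.taylor_mul_val (n : ℕ) (a : Hol U ℂ) (f : Hol U V) (u : U) :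
    (Hol.taylor n (Hol.mul a f)).1 u = ∑ p ∈ Finset.HasAntidiagonal.antidiagonal n,
      (Hol.taylor p.1 a).1 u • (Hol.taylor p.2 f).1 u := by
  rw [Hol.taylor_mul, Hol.sum_val]
  rfl

theorem Hol.taylor_coord (k : ℕ) (u : U) :
    (Hol.taylor k (Hol.coord u : Hol U ℂ)).1 u = if k = 1 then 1 else 0 := by
  rcases k with _ | _ | k
  · rw [Hol.taylor_zero]; simp [Hol.coord]
  · simp [Hol.taylor, Hol.D_coord, Hol.const]
  · simp [Hol.taylor, pow_succ, Hol.D_coord, Hol.D_const]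

theorem Hol.taylor_zero_coord_mul (f : Hol U V) (u : U) :
    (Hol.taylor 0 (Hol.mul (Hol.coord u) f)).1 u = 0 := by
  simp [Hol.taylor_mul_val, Hol.taylor_coord]

theorem Hol.taylor_succ_coord_mul (k : ℕ) (f : Hol U V) (u : U) :
    (Hol.taylor (k + 1) (Hol.mul (Hol.coord u) f)).1 u = (Hol.taylor k f).1 u := by
  rw [Hol.taylor_mul_val, Finset.sum_eq_single (1, k)]
  · simp [Hol.taylor_coord]
  · rintro ⟨i, j⟩ hp hne
    have : i ≠ 1 := fun h => hne (by
      rw [Finset.HasAntidiagonal.mem_antidiagonal] at hp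
      simp only [Prod.mk.injEq]
      omega)
    simp [Hol.taylor_coord, this]
  · intro h
    exact absurd (Finset.HasAntidiagonal.mem_antidiagonal.2 (add_comm 1 k)) h

theorem Hol.taylor_coord_mul_iterate (l k : ℕ) (f : Hol U V) (u : U) :
    (Hol.taylor k ((Hol.mul (Hol.coord u))^[l] f)).1 u =
      if l ≤ k then (Hol.taylor (k - l) f).1 u else 0 := by
  induction l generalizing k with
  | zero => simp
  | succ l ih =>
    rw [Function.iterate_succ_apply']
    rcases k with _ | k
    · rw [Hol.taylor_zero_coord_mul]; simp
    · rw [Hol.taylor_succ_coord_mul, ih]; simp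

/-- Division by `u - u₀`. -/
theorem Hol.exists_eq_add_coord_mul (f : Hol U V) (u : U) :
    ∃ h : Hol U V, f = Hol.const (f.1 u) + Hol.mul (Hol.coord u) h := by
  have hU : (U : Set ℂ) ∈ 𝓝 (u : ℂ) := U.isOpen.mem_nhds u.2
  have hd : DifferentiableOn ℂ (dslope (ext f.1) u) U :=
    (Complex.differentiableOn_dslope hU).2 fun w hw =>
      (f.2 ⟨w, hw⟩).differentiableAt.differentiableWithinAt
  refine ⟨⟨fun w => dslope (ext f.1) u w, IsAnalytic.of_eq (dslope (ext f.1) u)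
    (fun w => hd.analyticAt (U.isOpen.mem_nhds w.2)) (fun _ => rfl)⟩, ?_⟩
  ext w
  have := sub_smul_dslope (ext f.1) u w
  rw [ext_apply, ext_apply] at this
  change f.1 w = f.1 u + ((w : ℂ) - u) • dslope (ext f.1) u w
  rw [this]
  abel

/-- Interpolation of a jet by a polynomial. -/
theorem Hol.exists_taylor_eq (n : ℕ) (u : U) (v : ℕ → V) :
    ∃ f : Hol U V, ∀ k < n, (Hol.taylor k f).1 u = v k := by
  induction n generalizing v with
  | zero => exact ⟨0, by simp⟩
  | succ n ih =>
    obtain ⟨h, hh⟩ := ih fun k => v (k + 1)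
    refine ⟨Hol.const (v 0) + Hol.mul (Hol.coord u) h, fun k hk => ?_⟩
    rw [map_add, Hol.add_val]
    rcases k with _ | k
    · rw [Hol.taylor_zero_coord_mul, Hol.taylor_zero, add_zero]; rfl
    · rw [Hol.taylor_succ_coord_mul, Hol.taylor_const, hh k (by omega)]
      exact zero_add _

end Taylor

/-! ### Composition with a conformal equivalence -/

section Chain

variable {W U : Opens ℂ} {V : Type*} [NormedAddCommGroup V] [NormedSpace ℂ V]

theorem ConformalEquiv.pull_mul (ψ : ConformalEquiv W U) (a : Hol U ℂ) (f : Hol U V) :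
    ψ.pull (Hol.mul a f) = Hol.mul (ψ.pull a) (ψ.pull f) := rfl

theorem ConformalEquiv.pull_symm_pull (ψ : ConformalEquiv W U) (f : Hol U V) :
    ψ.symm.pull (ψ.pull f) = f := by
  ext u
  exact congrArg f.1 (ψ.toEquiv.apply_symm_apply u)

theorem ConformalEquiv.pull_pull_symm (ψ : ConformalEquiv W U) (f : Hol W V) :
    ψ.pull (ψ.symm.pull f) = f :=
  ψ.symm.pull_symm_pull f

/-- On the disc the conformal map `ψ⁻¹` becomes the coordinate, so the acceptability condition for
`ψ⁻¹` controls multiplication by `u - c`. -/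
theorem ConformalEquiv.pull_symm_hol (ψ : ConformalEquiv W U) (c : ℂ) :
    ψ.pull (ψ.symm.hol - Hol.const c) = Hol.coord c := by
  ext w
  change ((ψ.toEquiv.symm (ψ.toEquiv w) : W) : ℂ) - c = w - c
  rw [ψ.toEquiv.symm_apply_apply]

theorem ConformalEquiv.taylor_pull_coord (ψ : ConformalEquiv W U) (k : ℕ) (w : W) :
    (Hol.taylor k (ψ.pull (Hol.coord (ψ.toEquiv w : U)))).1 w =
      if k = 0 then 0 else (Hol.taylor k ψ.hol).1 w := by
  rcases k with _ | k
  · rw [Hol.taylor_zero]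
    exact sub_self _
  · have h : ψ.pull (Hol.coord (ψ.toEquiv w : U)) =
        ψ.hol - Hol.const ((ψ.toEquiv w : U) : ℂ) := rfl
    rw [h, map_sub, Hol.taylor_const, sub_zero, if_neg k.succ_ne_zero]

theorem fdb_zero (ψ : ConformalEquiv W U) (m : ℕ) (w : W) :
    fdb ψ m 0 w = if m = 0 then 1 else 0 := by
  rw [fdb, pow_zero, PowerSeries.coeff_one]

theorem fdb_succ (ψ : ConformalEquiv W U) (m k : ℕ) (w : W) :
    fdb ψ m (k + 1) w = ∑ p ∈ Finset.HasAntidiagonal.antidiagonal m,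
      (Hol.taylor p.1 (ψ.pull (Hol.coord (ψ.toEquiv w : U)))).1 w * fdb ψ p.2 k w := by
  rw [fdb, pow_succ', PowerSeries.coeff_mul]
  refine Finset.sum_congr rfl fun p _ => ?_
  rw [PowerSeries.coeff_mk, ψ.taylor_pull_coord, fdb]

/-- The Faà di Bruno formula. -/
theorem ConformalEquiv.taylor_pull [CompleteSpace V] (ψ : ConformalEquiv W U) (m n : ℕ)
    (hmn : m < n) (f : Hol U V) (w : W) :
    (Hol.taylor m (ψ.pull f)).1 w =
      ∑ k ∈ Finset.range n, fdb ψ m k w • (Hol.taylor k f).1 (ψ.toEquiv w) := by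
  induction n generalizing m f with
  | zero => omega
  | succ n ih =>
    obtain ⟨h, hf⟩ := Hol.exists_eq_add_coord_mul f (ψ.toEquiv w)
    have hk : ∀ k, (Hol.taylor (k + 1) f).1 (ψ.toEquiv w) = (Hol.taylor k h).1 (ψ.toEquiv w) :=
      fun k => by
        rw [hf, map_add, Hol.add_val, Hol.taylor_const, Hol.taylor_succ_coord_mul]
        exact zero_add _
    rw [Finset.sum_range_succ']
    simp only [hk, fdb_succ, fdb_zero, Hol.taylor_zero, Finset.sum_smul]
    rw [Finset.sum_comm]
    have h0 : (Hol.taylor m (ψ.pull f)).1 w = (if m = 0 then (1 : ℂ) else 0) •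
        f.1 (ψ.toEquiv w) + (Hol.taylor m (Hol.mul
          (ψ.pull (Hol.coord (ψ.toEquiv w : U))) (ψ.pull h))).1 w := by
      have h1 : ψ.pull f = Hol.const (f.1 (ψ.toEquiv w)) +
          Hol.mul (ψ.pull (Hol.coord (ψ.toEquiv w : U))) (ψ.pull h) := by
        conv_lhs => rw [hf]
        rfl
      rw [h1, map_add, Hol.add_val]
      rcases m with _ | m
      · simp [Hol.taylor_zero, Hol.const]
      · simp [Hol.taylor_const]
    rw [h0, add_comm, Hol.taylor_mul_val]
    congr 1
    refine Finset.sum_congr rfl fun p hp => ?_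
    rw [Finset.HasAntidiagonal.mem_antidiagonal] at hp
    simp only [mul_smul, ← Finset.smul_sum]
    -- The factor `ψ - ψ(w)` has no constant term. Only `p.1 ≥ 1` contributes, and then `p.2 < n`,
    -- as the induction hypothesis for `h` requires.
    by_cases hp0 : p.1 = 0
    · rw [ψ.taylor_pull_coord, if_pos hp0, zero_smul, zero_smul]
    · rw [ih p.2 (by omega)]

theorem chain_val (ψ : ConformalEquiv W U) (n : ℕ) (H : Hol U (Fin n → V)) (w : W) (i : Fin n) :
    (chain ψ n H).1 w i = ∑ k : Fin n, fdb ψ i k w • H.1 (ψ.toEquiv w) k := by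
  change (∑ k : Fin n, Hol.mul ⟨fdb ψ i k, fdb_analytic ψ i k⟩ (Hol.comp k (ψ.pull H))).1 w = _
  rw [Hol.sum_val]
  rfl

variable [CompleteSpace V]

theorem chain_tuple_taylor (ψ : ConformalEquiv W U) (n : ℕ) (f : Hol U V) :
    chain ψ n (Hol.tuple fun i : Fin n => Hol.taylor i f) =
      Hol.tuple fun i : Fin n => Hol.taylor i (ψ.pull f) := by
  ext w i
  rw [chain_val, Hol.tuple_val, ψ.taylor_pull i n i.2, Finset.sum_range]
  rfl

theorem chain_symm_chain (ψ : ConformalEquiv W U) (n : ℕ) (H : Hol U (Fin n → V)) :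
    chain ψ.symm n (chain ψ n H) = H := by
  ext u i
  -- At a fixed point every vector is a jet, so inversion of the matrices reduces to `f ∘ ψ ∘ ψ⁻¹ =
  -- f` and the Faà di Bruno formula for `ψ` and `ψ⁻¹`.
  obtain ⟨f, hf⟩ := Hol.exists_taylor_eq n u
    fun k => if hk : k < n then H.1 u ⟨k, hk⟩ else 0
  have hf' : ∀ k : Fin n, (Hol.taylor k f).1 u = H.1 u k := fun k => by
    rw [hf k k.2, dif_pos k.2]
  have hu : ψ.toEquiv (ψ.symm.toEquiv u) = u := ψ.toEquiv.apply_symm_apply u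
  have h1 : ∀ k : Fin n, (chain ψ n H).1 (ψ.symm.toEquiv u) k =
      (Hol.taylor k (ψ.pull f)).1 (ψ.symm.toEquiv u) := fun k => by
    rw [chain_val, ψ.taylor_pull k n k.2, Finset.sum_range, hu]
    simp only [hf']
  rw [chain_val]
  simp only [h1]
  have h2 := ψ.symm.taylor_pull i n i.2 (ψ.pull f) u
  rw [Finset.sum_range] at h2
  rw [← h2, ψ.pull_symm_pull, hf']

theorem chain_chain_symm (ψ : ConformalEquiv W U) (n : ℕ) (H : Hol W (Fin n → V)) :
    chain ψ n (chain ψ.symm n H) = H :=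
  chain_symm_chain ψ.symm n H

theorem chain_injective (ψ : ConformalEquiv W U) (n : ℕ) :
    Function.Injective (chain (V := V) ψ n) :=
  Function.LeftInverse.injective (chain_symm_chain ψ n)

/-! ### Functions that vanish to a given order -/

/-- The analytic functions that vanish at `u` to order `n`. -/
def Hol.vanishing (n : ℕ) (u : U) : Submodule ℂ (Hol U V) where
  carrier := {f | ∀ k < n, (Hol.taylor k f).1 u = 0}
  zero_mem' k _ := by rw [map_zero]; rfl
  add_mem' {f g} hf hg k hk := by rw [map_add, Hol.add_val, hf k hk, hg k hk, add_zero]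
  smul_mem' c f hf k hk := by rw [map_smul, Hol.smul_val, hf k hk, smul_zero]

theorem Hol.mem_vanishing {n : ℕ} {u : U} {f : Hol U V} :
    f ∈ Hol.vanishing n u ↔ ∀ k < n, (Hol.taylor k f).1 u = 0 := Iff.rfl

theorem Hol.mul_mem_vanishing {n : ℕ} {u : U} (a : Hol U ℂ) {f : Hol U V}
    (hf : f ∈ Hol.vanishing n u) : Hol.mul a f ∈ Hol.vanishing n u := fun k hk => by
  rw [Hol.taylor_mul_val]
  refine Finset.sum_eq_zero fun p hp => ?_
  rw [Finset.HasAntidiagonal.mem_antidiagonal] at hp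
  rw [hf p.2 (by omega), smul_zero]

theorem Hol.mem_vanishing_pi {n m : ℕ} {u : U} {f : Hol U (Fin m → V)} :
    f ∈ Hol.vanishing n u ↔ ∀ i, Hol.comp i f ∈ Hol.vanishing n u := by
  simp only [Hol.mem_vanishing, Hol.taylor_comp, Hol.comp_val]
  exact ⟨fun h i k hk => congrFun (h k hk) i, fun h k hk => funext fun i => h i k hk⟩

theorem ConformalEquiv.pull_mem_vanishing (ψ : ConformalEquiv W U) {n : ℕ} {w : W} {f : Hol U V}
    (hf : f ∈ Hol.vanishing n (ψ.toEquiv w)) : ψ.pull f ∈ Hol.vanishing n w := fun k hk => by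
  rw [ψ.taylor_pull k n hk]
  exact Finset.sum_eq_zero fun i hi => by rw [hf i (Finset.mem_range.1 hi), smul_zero]

theorem ConformalEquiv.pull_mem_vanishing_iff (ψ : ConformalEquiv W U) {n : ℕ} {u : U}
    {f : Hol U V} :
    ψ.pull f ∈ Hol.vanishing n (ψ.symm.toEquiv u) ↔ f ∈ Hol.vanishing n u := by
  refine ⟨fun h => ?_, fun h => ψ.pull_mem_vanishing ?_⟩
  · rw [← ψ.pull_symm_pull f]
    exact ψ.symm.pull_mem_vanishing h
  · exact (ψ.toEquiv.apply_symm_apply u).symm ▸ h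

/-- The matrix entries are analytic, so by the Leibniz rule they cannot lower the order of
vanishing. -/
theorem chain_mem_vanishing (ψ : ConformalEquiv W U) {n m : ℕ} {w : W} {H : Hol U (Fin m → V)}
    (hH : H ∈ Hol.vanishing n (ψ.toEquiv w)) : chain ψ m H ∈ Hol.vanishing n w := by
  refine Hol.mem_vanishing_pi.2 fun i => ?_
  change ∑ k : Fin m, Hol.mul _ (Hol.comp k (ψ.pull H)) ∈ _
  exact Submodule.sum_mem _ fun k _ => Hol.mul_mem_vanishing _
    (Hol.mem_vanishing_pi.1 (ψ.pull_mem_vanishing hH) k)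

theorem chain_mem_vanishing_iff (ψ : ConformalEquiv W U) {n m : ℕ} {u : U}
    {H : Hol U (Fin m → V)} :
    chain ψ m H ∈ Hol.vanishing n (ψ.symm.toEquiv u) ↔ H ∈ Hol.vanishing n u := by
  refine ⟨fun h => ?_, fun h => chain_mem_vanishing ψ ?_⟩
  · rw [← chain_symm_chain ψ m H]
    exact chain_mem_vanishing ψ.symm h
  · exact (ψ.toEquiv.apply_symm_apply u).symm ▸ h

end Chain

/-! ### Operators between ranges with the quotient norm -/

section QuotientRange

variable {E Y E₁ Y₁ E₂ Y₂ : Type*}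
  [SeminormedAddCommGroup E] [NormedSpace ℂ E] [AddCommGroup Y] [Module ℂ Y]
  [SeminormedAddCommGroup E₁] [NormedSpace ℂ E₁] [AddCommGroup Y₁] [Module ℂ Y₁]
  [SeminormedAddCommGroup E₂] [NormedSpace ℂ E₂] [AddCommGroup Y₂] [Module ℂ Y₂]

theorem QuotientRange.mk_eq_zero {T : E →ₗ[ℂ] Y} {f : E} :
    QuotientRange.mk T f = 0 ↔ T f = 0 :=
  Subtype.ext_iff

theorem QuotientRange.norm_mk_le (T : E →ₗ[ℂ] Y) (f : E) : ‖QuotientRange.mk T f‖ ≤ ‖f‖ :=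
  (QuotientRange.norm_mk T f).trans_le (Submodule.Quotient.norm_mk_le _ f)

theorem QuotientRange.exists_norm_lt {T : E →ₗ[ℂ] Y} (x : QuotientRange T) {ε : ℝ} (hε : 0 < ε) :
    ∃ f, QuotientRange.mk T f = x ∧ ‖f‖ < ‖x‖ + ε := by
  obtain ⟨g, rfl⟩ := QuotientRange.mk_surjective T x
  obtain ⟨f, hf, hlt⟩ := Submodule.Quotient.norm_mk_lt
    (Submodule.Quotient.mk g : E ⧸ LinearMap.ker T) hε
  refine ⟨f, ?_, by rwa [QuotientRange.norm_mk]⟩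
  rw [← sub_eq_zero, ← map_sub, QuotientRange.mk_eq_zero]
  exact (Submodule.Quotient.eq _).1 hf

/-- The linear map between ranges induced by a linear map `A` that maps `ker T` into `ker T₁`. -/
def QuotientRange.linearMap {T : E →ₗ[ℂ] Y} {T₁ : E₁ →ₗ[ℂ] Y₁} (A : E →ₗ[ℂ] E₁)
    (h : ∀ f, T f = 0 → T₁ (A f) = 0) : QuotientRange T →ₗ[ℂ] QuotientRange T₁ :=
  (LinearMap.ker T).liftQ (QuotientRange.mk T₁ ∘ₗ A)
    (fun f hf => QuotientRange.mk_eq_zero.2 (h f hf)) ∘ₗ T.quotKerEquivRange.symm.toLinearMap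

theorem QuotientRange.linearMap_mk {T : E →ₗ[ℂ] Y} {T₁ : E₁ →ₗ[ℂ] Y₁} (A : E →ₗ[ℂ] E₁)
    (h : ∀ f, T f = 0 → T₁ (A f) = 0) (f : E) :
    QuotientRange.linearMap A h (QuotientRange.mk T f) = QuotientRange.mk T₁ (A f) :=
  congrArg ((LinearMap.ker T).liftQ (QuotientRange.mk T₁ ∘ₗ A)
    (fun f hf => QuotientRange.mk_eq_zero.2 (h f hf)))
    ((LinearEquiv.symm_apply_eq T.quotKerEquivRange).2 rfl :
      T.quotKerEquivRange.symm (T.rangeRestrict f) = Submodule.Quotient.mk f)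

/-- The operator between ranges induced by an operator `A` that maps `ker T` into `ker T₁`. -/
def QuotientRange.map {T : E →ₗ[ℂ] Y} {T₁ : E₁ →ₗ[ℂ] Y₁} (A : E →L[ℂ] E₁)
    (h : ∀ f, T f = 0 → T₁ (A f) = 0) : QuotientRange T →L[ℂ] QuotientRange T₁ :=
  (QuotientRange.linearMap A.toLinearMap h).mkContinuous ‖A‖ fun x => by
    refine le_of_forall_pos_lt_add fun ε hε => ?_
    have hA : 0 < ‖A‖ + 1 := by positivity
    -- The infimum in the quotient norm need not be attained. Dividing by `‖A‖ + 1` also covers `‖A‖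
    -- = 0`.
    obtain ⟨f, rfl, hf⟩ := QuotientRange.exists_norm_lt x (div_pos hε hA)
    rw [QuotientRange.linearMap_mk]
    calc ‖QuotientRange.mk T₁ (A f)‖ ≤ ‖A‖ * ‖f‖ :=
          (QuotientRange.norm_mk_le T₁ _).trans (A.le_opNorm f)
      _ ≤ ‖A‖ * (‖QuotientRange.mk T f‖ + ε / (‖A‖ + 1)) := by gcongr
      _ < ‖A‖ * ‖QuotientRange.mk T f‖ + ε := by
          rw [mul_add]
          gcongr
          rw [← mul_div_assoc, div_lt_iff₀ hA]
          nlinarith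

theorem QuotientRange.map_mk {T : E →ₗ[ℂ] Y} {T₁ : E₁ →ₗ[ℂ] Y₁} (A : E →L[ℂ] E₁)
    (h : ∀ f, T f = 0 → T₁ (A f) = 0) (f : E) :
    QuotientRange.map A h (QuotientRange.mk T f) = QuotientRange.mk T₁ (A f) :=
  QuotientRange.linearMap_mk A.toLinearMap h f

theorem QuotientRange.mk_eq_mk {T : E →ₗ[ℂ] Y} {f g : E} (h : T (f - g) = 0) :
    QuotientRange.mk T f = QuotientRange.mk T g := by
  rw [← sub_eq_zero, ← map_sub, QuotientRange.mk_eq_zero, h]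

/-- A splitting of `E` that is compatible with the kernels of `T`, `T₁` and `T₂` induces a
splitting of the range of `T`. -/
theorem QuotientRange.exists_equiv_prod {T : E →ₗ[ℂ] Y} {T₁ : E₁ →ₗ[ℂ] Y₁} {T₂ : E₂ →ₗ[ℂ] Y₂}
    (P : E →L[ℂ] E₁) (Q : E →L[ℂ] E₂) (I : E₁ →L[ℂ] E) (R : E₂ →L[ℂ] E)
    (hT : ∀ f, T f = 0 ↔ T₁ (P f) = 0 ∧ T₂ (Q f) = 0)
    (hPI : ∀ g, P (I g) = g) (hQI : ∀ g, Q (I g) = 0)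
    (hPR : ∀ g, P (R g) = 0) (hQR : ∀ g, T₂ (Q (R g) - g) = 0) :
    ∃ J : QuotientRange T ≃L[ℂ] QuotientRange T₁ × QuotientRange T₂,
      ∀ g, J (QuotientRange.mk T (I g)) = (QuotientRange.mk T₁ g, 0) := by
  have hR : ∀ g, T₂ g = 0 → T (R g) = 0 := fun g hg => (hT _).2
    ⟨by rw [hPR, map_zero], by simpa [hg] using hQR g⟩
  have hI : ∀ g, T₁ g = 0 → T (I g) = 0 := fun g hg => (hT _).2
    ⟨by rw [hPI, hg], by rw [hQI, map_zero]⟩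
  let P' := QuotientRange.map (T := T) (T₁ := T₁) P fun f hf => ((hT f).1 hf).1
  let Q' := QuotientRange.map (T := T) (T₁ := T₂) Q fun f hf => ((hT f).1 hf).2
  let I' := QuotientRange.map I hI
  let R' := QuotientRange.map R hR
  refine ⟨ContinuousLinearEquiv.equivOfInverse (P'.prod Q') (I'.coprod R') ?_ ?_, ?_⟩
  · intro x
    obtain ⟨f, rfl⟩ := QuotientRange.mk_surjective T x
    simp only [ContinuousLinearMap.prod_apply, ContinuousLinearMap.coprod_apply, P', Q', I', R',
      QuotientRange.map_mk]
    rw [← map_add]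
    -- `P` kills the defect `I P f + R Q f - f`, and `Q` sends it into the kernel of `T₂`; hence the
    -- defect lies in the kernel of `T`.
    refine QuotientRange.mk_eq_mk ((hT _).2 ⟨?_, ?_⟩)
    · simp [hPI, hPR]
    · simpa [hQI] using hQR (Q f)
  · rintro ⟨x, y⟩
    obtain ⟨f, rfl⟩ := QuotientRange.mk_surjective T₁ x
    obtain ⟨g, rfl⟩ := QuotientRange.mk_surjective T₂ y
    simp only [ContinuousLinearMap.prod_apply, ContinuousLinearMap.coprod_apply, P', Q', I', R',
      QuotientRange.map_mk]
    rw [← map_add, QuotientRange.map_mk, QuotientRange.map_mk]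
    refine Prod.ext (QuotientRange.mk_eq_mk ?_) (QuotientRange.mk_eq_mk ?_)
    · simp [hPI, hPR]
    · simpa [hQI] using hQR g
  · intro g
    change (P' _, Q' _) = _
    simp only [P', Q', QuotientRange.map_mk, hPI, hQI, map_zero]

end QuotientRange

/-! ### Complemented subspaces obtained from a direct sum decomposition -/

section Complement

variable {X Y Z : Type*} [SeminormedAddCommGroup X] [NormedSpace ℂ X]
  [SeminormedAddCommGroup Y] [NormedSpace ℂ Y] [SeminormedAddCommGroup Z] [NormedSpace ℂ Z]

/-- The first summand of a direct sum is complemented and the quotient is the second one. -/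
theorem embedding_complemented_of_equiv_prod (J : X ≃L[ℂ] Y × Z) (I : Y →L[ℂ] X)
    (h : ∀ y, J (I y) = (y, 0)) :
    Topology.IsEmbedding I ∧ I.range.ClosedComplemented ∧ Nonempty ((X ⧸ I.range) ≃L[ℂ] Z) := by
  let P : X →L[ℂ] Y := (ContinuousLinearMap.fst ℂ Y Z).comp J.toContinuousLinearMap
  let Q : X →L[ℂ] Z := (ContinuousLinearMap.snd ℂ Y Z).comp J.toContinuousLinearMap
  let R : Z →L[ℂ] X := J.symm.toContinuousLinearMap.comp (ContinuousLinearMap.inr ℂ Y Z)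
  have hPI : Function.LeftInverse P I := fun y => congrArg Prod.fst (h y)
  have hQI : I.range ≤ Q.ker := by
    rintro _ ⟨y, rfl⟩
    exact congrArg Prod.snd (h y)
  have hsum : ∀ x, x = I (P x) + R (Q x) := fun x => J.injective <| by
    have : J (R (Q x)) = (0, Q x) := J.apply_symm_apply _
    rw [map_add, h, this]
    exact Prod.ext (add_zero (P x)).symm (zero_add (Q x)).symm
  refine ⟨hPI.isEmbedding P.continuous I.continuous,
    ContinuousLinearMap.HasLeftInverse.closedComplemented_range ⟨P, hPI⟩,
    ⟨ContinuousLinearEquiv.equivOfInverse (I.range.liftQL Q hQI) (I.range.mkQL.comp R) ?_ ?_⟩⟩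
  · intro x
    obtain ⟨x, rfl⟩ := I.range.mkQ_surjective x
    change I.range.mkQ (R (Q x)) = I.range.mkQ x
    rw [← sub_eq_zero, ← map_sub, Submodule.mkQ_apply, Submodule.Quotient.mk_eq_zero]
    refine ⟨-P x, ?_⟩
    change I (-P x) = R (Q x) - x
    rw [map_neg, eq_sub_iff_add_eq]
    exact neg_add_eq_of_eq_add (hsum x)
  · intro y
    exact congrArg Prod.snd (J.apply_symm_apply (0, y))

end Complement

/-! ### The derived spaces as finite powers -/

section Derived

variable {W U : Opens ℂ} {V : Type*} [NormedAddCommGroup V] [NormedSpace ℂ V]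

/-- The elements of a space of analytic functions, as analytic functions. -/
def FunSpace.incl (F : FunSpace U V) : F.Elem →ₗ[ℂ] Hol U V := F.carrier.subtype

theorem FunSpace.incl_injective (F : FunSpace U V) : Function.Injective F.incl :=
  Subtype.val_injective

theorem FunSpace.norm_elem (F : FunSpace U V) (f : F.Elem) (h : F.incl f ∈ F.carrier) :
    ‖f‖ = F.nrm ⟨F.incl f, h⟩ := rfl

theorem FunSpace.incl_mem (F : FunSpace U V) (f : F.Elem) : F.incl f ∈ F.carrier :=
  Subtype.prop (p := fun f => f ∈ F.carrier) f

/-- `F` and `ψ^*[F]` have the same elements. -/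
def FunSpace.toPullback (F : FunSpace U V) (ψ : ConformalEquiv W U) (f : F.Elem) :
    (F.pullback ψ).Elem :=
  (⟨ψ.pull (F.incl f), Submodule.mem_comap.2
    ((ψ.pull_symm_pull (F.incl f)).symm ▸ F.incl_mem f)⟩ : (F.pullback ψ).carrier)

theorem FunSpace.norm_toPullback (F : FunSpace U V) (ψ : ConformalEquiv W U) (f : F.Elem) :
    ‖F.toPullback ψ f‖ = ‖f‖ :=
  congrArg F.nrm (Subtype.ext (ψ.pull_symm_pull (F.incl f)))

variable [CompleteSpace V]

/-- `(a_l)_l ↦ (∑_{l ≤ k} τ_{k-l} a_l)_k`. -/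
def assemble (m : ℕ) : (Fin m → Hol U V) →ₗ[ℂ] Hol U (Fin m → V) :=
  Hol.tuple ∘ₗ LinearMap.pi fun k : Fin m => ∑ l : Fin m,
    (if (l : ℕ) ≤ k then Hol.taylor ((k : ℕ) - l) else 0) ∘ₗ LinearMap.proj l

theorem comp_assemble {m : ℕ} (a : Fin m → Hol U V) (k : Fin m) :
    Hol.comp k (assemble m a) =
      ∑ l : Fin m, if (l : ℕ) ≤ k then Hol.taylor ((k : ℕ) - l) (a l) else 0 := by
  rw [assemble, LinearMap.comp_apply, Hol.comp_tuple, LinearMap.pi_apply, LinearMap.sum_apply]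
  refine Finset.sum_congr rfl fun l _ => ?_
  split_ifs <;> rfl

theorem comp_zero_assemble {m : ℕ} (a : Fin (m + 1) → Hol U V) :
    Hol.comp 0 (assemble (m + 1) a) = a 0 := by
  rw [comp_assemble, Fin.sum_univ_succ]
  simp [Hol.taylor_zero]

theorem comp_twist {n : ℕ} (g : Hol U (Fin (n + 1) → V)) (i : Fin n) :
    Hol.comp i (twist g) = Hol.comp i.succ g - Hol.taylor ((i : ℕ) + 1) (Hol.comp 0 g) := rfl

/-- The twist subtracts exactly the contribution `τ_{k+1} a_0` of the first entry. This makes the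
recursion for the derived spaces a recursion on tuples. -/
theorem twist_assemble {m : ℕ} (a : Fin (m + 1) → Hol U V) :
    twist (assemble (m + 1) a) = assemble m fun l => a l.succ := by
  refine Hol.ext_comp fun k => ?_
  rw [comp_twist, comp_zero_assemble, comp_assemble, comp_assemble, Fin.sum_univ_succ]
  simp

theorem eq_of_twist_eq {n : ℕ} {g h : Hol U (Fin (n + 1) → V)} (h₁ : twist g = twist h)
    (h₀ : Hol.comp 0 g = Hol.comp 0 h) : g = h := by
  refine Hol.ext_comp fun i => ?_
  induction i using Fin.cases with
  | zero => exact h₀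
  | succ i =>
    have := congrArg (Hol.comp i) h₁
    rwa [comp_twist, comp_twist, h₀, sub_left_inj] at this

theorem assemble_injective (m : ℕ) : Function.Injective (assemble (U := U) (V := V) m) := by
  induction m with
  | zero => exact fun a b _ => Subsingleton.elim a b
  | succ m ih =>
    intro a b h
    funext l
    induction l using Fin.cases with
    | zero => rw [← comp_zero_assemble a, h, comp_zero_assemble]
    | succ l =>
      have := congrArg twist h
      rw [twist_assemble, twist_assemble] at this
      exact congrFun (ih this) l

theorem FunSpace.assemble_mem_derived (F : FunSpace U V) (m : ℕ) (a : Fin m → F.Elem) :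
    ∃ h : assemble m (fun l => F.incl (a l)) ∈ (F.derived m).carrier,
      (F.derived m).nrm ⟨_, h⟩ = ∑ l, ‖a l‖ := by
  induction m with
  | zero => exact ⟨Submodule.mem_top, rfl⟩
  | succ m ih =>
    obtain ⟨h, hn⟩ := ih fun l => a l.succ
    have h₁ := twist_assemble fun l => F.incl (a l)
    have h₀ := comp_zero_assemble fun l => F.incl (a l)
    have hmem : assemble (m + 1) (fun l => F.incl (a l)) ∈ (F.derived (m + 1)).carrier :=
      Submodule.mem_inf.2 ⟨Submodule.mem_comap.2 (h₁ ▸ h),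
        Submodule.mem_comap.2 (h₀ ▸ F.incl_mem (a 0))⟩
    refine ⟨hmem, ?_⟩
    have hsum : (F.derived (m + 1)).nrm ⟨_, hmem⟩ =
        (F.derived m).nrm ⟨_, (Submodule.mem_inf.1 hmem).1⟩ +
          F.nrm ⟨_, (Submodule.mem_inf.1 hmem).2⟩ := rfl
    rw [hsum, Fin.sum_univ_succ, add_comm, F.norm_elem (a 0) (F.incl_mem _), ← hn]
    congr 2
    · exact Subtype.ext h₀
    · exact Subtype.ext h₁

/-- The entry `a_0` is the zeroth component of `g`; the remaining entries are recovered recursively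
from the twist of `g`. -/
theorem FunSpace.exists_assemble_eq (F : FunSpace U V) (m : ℕ) (g : Hol U (Fin m → V))
    (hg : g ∈ (F.derived m).carrier) :
    ∃ a : Fin m → F.Elem, assemble m (fun l => F.incl (a l)) = g := by
  induction m with
  | zero => exact ⟨fun l => l.elim0, Hol.ext_comp fun i => i.elim0⟩
  | succ m ih =>
    obtain ⟨h₁, h₀⟩ := Submodule.mem_inf.1 hg
    obtain ⟨b, hb⟩ := ih (twist g) h₁
    refine ⟨Fin.cons (⟨_, h₀⟩ : F.carrier) b, eq_of_twist_eq ?_ ?_⟩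
    · rw [twist_assemble, ← hb]
      rfl
    · rw [comp_zero_assemble]
      rfl

theorem FunSpace.chain_assemble_mem (F : FunSpace U V) (ψ : ConformalEquiv disc U) (m : ℕ)
    (a : Fin m → F.Elem) :
    ∃ h : chain ψ.symm m (assemble m fun l => ψ.pull (F.incl (a l))) ∈ (F.derivedOn ψ m).carrier,
      (F.derivedOn ψ m).nrm ⟨_, h⟩ = ∑ l, ‖a l‖ := by
  obtain ⟨h, hn⟩ := (F.pullback ψ).assemble_mem_derived m fun l => F.toPullback ψ (a l)
  have hc := chain_chain_symm ψ m (assemble m fun l => ψ.pull (F.incl (a l)))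
  refine ⟨Submodule.mem_comap.2 (hc.symm ▸ h), ?_⟩
  simp only [F.norm_toPullback] at hn
  rw [← hn]
  exact congrArg ((F.pullback ψ).derived m).nrm (Subtype.ext hc)

/-- The space `T` attached to `F` is a finite power of `F`. -/
theorem FunSpace.exists_equiv_derivedOn (F : FunSpace U V) (ψ : ConformalEquiv disc U) (m : ℕ) :
    ∃ L : (Fin m → F.Elem) ≃L[ℂ] (F.derivedOn ψ m).Elem, ∀ a,
      chain ψ m ((F.derivedOn ψ m).incl (L a)) = assemble m fun l => ψ.pull (F.incl (a l)) := by
  let A : (Fin m → F.Elem) →ₗ[ℂ] Hol U (Fin m → V) :=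
    chain ψ.symm m ∘ₗ assemble m ∘ₗ LinearMap.pi fun l => ψ.pull ∘ₗ F.incl ∘ₗ LinearMap.proj l
  let L : (Fin m → F.Elem) →ₗ[ℂ] (F.derivedOn ψ m).Elem :=
    A.codRestrict (F.derivedOn ψ m).carrier fun a => (F.chain_assemble_mem ψ m a).1
  have hL : ∀ a, chain ψ m ((F.derivedOn ψ m).incl (L a)) =
      assemble m fun l => ψ.pull (F.incl (a l)) := fun a => chain_chain_symm ψ m _
  have hn : ∀ a, ‖L a‖ = ∑ l, ‖a l‖ := fun a => (F.chain_assemble_mem ψ m a).2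
  have hb : Function.Bijective L := by
    refine ⟨fun a b hab => ?_, fun H => ?_⟩
    · have h := congrArg (fun H => chain ψ m ((F.derivedOn ψ m).incl H)) hab
      simp only [hL] at h
      funext l
      have hl := congrArg (fun f : Hol disc V => ψ.symm.pull f)
        (congrFun (assemble_injective m h) l)
      simp only [ψ.pull_symm_pull] at hl
      exact F.incl_injective hl
    · obtain ⟨a, ha⟩ := (F.pullback ψ).exists_assemble_eq m
        (chain ψ m ((F.derivedOn ψ m).incl H)) ((F.derivedOn ψ m).incl_mem H)
      let b : Fin m → F.Elem := fun l => (⟨ψ.symm.pull ((F.pullback ψ).incl (a l)),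
        (F.pullback ψ).incl_mem (a l)⟩ : F.carrier)
      refine ⟨b, (F.derivedOn ψ m).incl_injective (chain_injective ψ m ?_)⟩
      rw [hL, ← ha]
      congr 1
      funext l
      exact ψ.pull_pull_symm _
  -- The norm on the target is the `ℓ¹` sum while the tuple carries the sup norm; hence the
  -- constants `m` and `1`.
  refine ⟨(LinearEquiv.ofBijective L hb).toContinuousLinearEquivOfBounds m 1
    (fun a => ?_) (fun H => ?_), hL⟩
  · rw [LinearEquiv.ofBijective_apply, hn]
    calc ∑ l, ‖a l‖ ≤ ∑ _l : Fin m, ‖a‖ := Finset.sum_le_sum fun l _ => norm_le_pi_norm a l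
      _ = m * ‖a‖ := by simp
  · obtain ⟨a, rfl⟩ := (LinearEquiv.ofBijective L hb).surjective H
    rw [LinearEquiv.symm_apply_apply, LinearEquiv.ofBijective_apply, hn, one_mul]
    exact (pi_norm_le_iff_of_nonneg (Finset.sum_nonneg fun l _ => norm_nonneg _)).2 fun l =>
      Finset.single_le_sum (f := fun l => ‖a l‖) (fun l _ => norm_nonneg _) (Finset.mem_univ l)

end Derived

/-! ### Kernels of jets -/

section Kernel

variable {W U : Opens ℂ} {V : Type*} [NormedAddCommGroup V] [NormedSpace ℂ V]

theorem Hol.sub_const_mul (a : Hol U ℂ) (c : ℂ) (f : Hol U V) :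
    Hol.mul (a - Hol.const c) f = Hol.mul a f - c • f := by
  ext u; exact sub_smul (a.1 u) c (f.1 u)

/-- Multiplication by `φ - c`, where `φ` is a conformal equivalence, is bounded on `F`. -/
theorem FunSpace.IsAcceptable.exists_coord_mul {F : FunSpace U V} [CompleteSpace V]
    (hF : F.IsAcceptable) (ψ : ConformalEquiv disc U) (c : ℂ) :
    ∃ M : F.Elem →L[ℂ] F.Elem, ∀ f,
      ψ.pull (F.incl (M f)) = Hol.mul (Hol.coord c) (ψ.pull (F.incl f)) := by
  obtain ⟨K, hK, h⟩ := hF.divide ψ.symm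
  let A : F.Elem →ₗ[ℂ] Hol U V :=
    { toFun := fun f => Hol.mul ψ.symm.hol (F.incl f)
      map_add' := fun f g => by rw [map_add, Hol.mul_add]
      map_smul' := fun c f => by rw [map_smul, Hol.mul_smul]; rfl }
  let B : F.Elem →ₗ[ℂ] F.Elem := A.codRestrict F.carrier fun f => (h _).1.2 (F.incl_mem f)
  have hB : ∀ f, ‖B f‖ ≤ K * ‖f‖ := fun f =>
    (inv_mul_le_iff₀ hK).1 ((h (F.incl f)).2 (F.incl_mem f) ((h _).1.2 (F.incl_mem f))).1
  refine ⟨B.mkContinuous K hB - c • ContinuousLinearMap.id ℂ F.Elem, fun f => ?_⟩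
  rw [← ψ.pull_symm_hol c, ← ψ.pull_mul, Hol.sub_const_mul]
  rfl

/-- Elimination in the systems that describe the kernels of the jets of length `m` of pairs. -/
theorem elimination {m : ℕ} (hm : 1 ≤ m) (p q : ℕ → V) (hq : q 0 = 0) :
    (∀ k < m, p k = 0 ∧ ((k : ℂ) + 1) • p (k + 1) - q (k + 1) = 0) ↔
      (∀ j < m + 1, p j - (m : ℂ)⁻¹ • q j = 0) ∧ ∀ j < m - 1, q (j + 1) = 0 := by
  have hm' : (m : ℂ) ≠ 0 := Nat.cast_ne_zero.2 (by omega)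
  constructor
  · intro h
    -- The equations `p k = 0` reduce the others to `q (k + 1) = 0` as long as `k + 1 < m`. The last
    -- one, `m • p m = q m`, survives and is what `p - m⁻¹ q` records in degree `m`.
    have hq' : ∀ j < m, q j = 0 := fun j hj => by
      rcases j with _ | j
      · exact hq
      · have := (h j (by omega)).2
        rwa [(h (j + 1) hj).1, smul_zero, zero_sub, neg_eq_zero] at this
    refine ⟨fun j hj => ?_, fun j hj => hq' _ (by omega)⟩
    rcases Nat.lt_succ_iff_lt_or_eq.1 hj with hj | rfl
    · rw [(h j hj).1, hq' j hj, smul_zero, sub_zero]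
    · obtain ⟨k, rfl⟩ := Nat.exists_eq_add_of_le' hm
      have := (h k (by omega)).2
      rw [sub_eq_zero] at this
      rw [← this, smul_smul]
      push_cast at hm' ⊢
      rw [inv_mul_cancel₀ hm', one_smul, sub_self]
  · rintro ⟨h₁, h₂⟩ k hk
    have hq' : ∀ j < m, q j = 0 := fun j hj => by
      rcases j with _ | j
      · exact hq
      · exact h₂ j (by omega)
    have hp : ∀ j < m, p j = 0 := fun j hj => by
      simpa [hq' j hj] using h₁ j (by omega)
    refine ⟨hp k hk, ?_⟩
    rcases Nat.lt_or_ge (k + 1) m with hk' | hk'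
    · rw [hp _ hk', hq' _ hk', smul_zero, sub_zero]
    · obtain rfl : m = k + 1 := by omega
      have := sub_eq_zero.1 (h₁ (k + 1) (by omega))
      push_cast at this hm'
      rw [this, smul_smul, mul_inv_cancel₀ hm', one_smul, sub_self]

variable [CompleteSpace V]

theorem FunSpace.jet_eq_zero (F : FunSpace U V) (z : U) (n : ℕ) (f : F.Elem) :
    F.jet z n f = 0 ↔ F.incl f ∈ Hol.vanishing n z :=
  ⟨fun h k hk => congrFun h ⟨k, hk⟩, fun h => funext fun i => h i i.2⟩

/-- The order of vanishing is conformally invariant, so kernels of jets can be computed on the disc,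
where the operator `M` is multiplication by `u - w`. -/
theorem FunSpace.jet_eq_zero_iff_pull (F : FunSpace U V) (ψ : ConformalEquiv W U) (z : U) (n : ℕ)
    (f : F.Elem) :
    F.jet z n f = 0 ↔
      ∀ j < n, (Hol.taylor j (ψ.pull (F.incl f))).1 (ψ.symm.toEquiv z) = 0 := by
  rw [F.jet_eq_zero, ← ψ.pull_mem_vanishing_iff]
  rfl

theorem taylor_comp_assemble {m : ℕ} (a : Fin m → Hol U V) (k : Fin m) (i : ℕ) (u : U) :
    (Hol.taylor i (Hol.comp k (assemble m a))).1 u = ∑ l : Fin m, if (l : ℕ) ≤ k then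
      (((i + (k - l)).factorial : ℂ) / (i.factorial * ((k : ℕ) - l).factorial)) •
        (Hol.taylor (i + (k - l)) (a l)).1 u else 0 := by
  rw [comp_assemble, map_sum, Hol.sum_val]
  refine Finset.sum_congr rfl fun l _ => ?_
  split_ifs
  · rw [Hol.taylor_taylor]
    rfl
  · rw [map_zero]
    rfl

/-- The Faà di Bruno matrices and their inverses are analytic, so the kernel condition is read off
from the assembled tuple on the disc. -/
theorem FunSpace.jet_derivedOn_eq_zero (F : FunSpace U V) (ψ : ConformalEquiv disc U) (z : U)
    (m n : ℕ) (a : Fin m → F.Elem) (H : (F.derivedOn ψ m).Elem)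
    (hH : chain ψ m ((F.derivedOn ψ m).incl H) = assemble m fun l => ψ.pull (F.incl (a l))) :
    (F.derivedOn ψ m).jet z n H = 0 ↔ ∀ k : Fin m, ∀ i < n,
      (Hol.taylor i (Hol.comp k (assemble m fun l => ψ.pull (F.incl (a l))))).1
        (ψ.symm.toEquiv z) = 0 := by
  rw [FunSpace.jet_eq_zero, ← chain_mem_vanishing_iff ψ, hH, Hol.mem_vanishing_pi]
  rfl

end Kernel

/-! ### The splittings -/

section Splitting

variable {U : Opens ℂ} {V : Type*} [NormedAddCommGroup V] [NormedSpace ℂ V] [CompleteSpace V]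

/-- The splitting is induced by `P(a_0, a_1) = a_0 + m⁻¹ t a_1` and `Q(a_0, a_1) = a_1`. The
condition on `J` places the pairs `(f', f)` in the first summand. -/
theorem exists_equiv_prod_two (F : FunSpace U V) (hF : F.IsAcceptable)
    (ψ : ConformalEquiv disc U) (m : ℕ) (hm : 1 ≤ m) (z : U) :
    ∃ J : F.Iterated ψ z 2 m ≃L[ℂ] F.RochbergSpace z (m + 1) × F.RochbergSpace z (m - 1),
      ∀ (f : F.Elem) (H : (F.derivedOn ψ 2).Elem),
        (F.derivedOn ψ 2).incl H = Hol.tuple (fun i : Fin 2 => Hol.taylor i (F.incl f)) →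
        J (QuotientRange.mk _ H) = (QuotientRange.mk _ f, 0) := by
  obtain ⟨M, hM⟩ := hF.exists_coord_mul ψ (ψ.symm.toEquiv z : disc)
  obtain ⟨L, hL⟩ := F.exists_equiv_derivedOn ψ 2
  let π : Fin 2 → (Fin 2 → F.Elem) →L[ℂ] F.Elem := fun i =>
    ContinuousLinearMap.proj (R := ℂ) (φ := fun _ : Fin 2 => F.Elem) i
  let ι : Fin 2 → F.Elem →L[ℂ] (Fin 2 → F.Elem) := fun i =>
    ContinuousLinearMap.single ℂ (fun _ : Fin 2 => F.Elem) i
  let T : F.Elem →L[ℂ] F.Elem := (m : ℂ)⁻¹ • M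
  let P : (F.derivedOn ψ 2).Elem →L[ℂ] F.Elem :=
    (π 0 + T.comp (π 1)).comp L.symm.toContinuousLinearMap
  let Q : (F.derivedOn ψ 2).Elem →L[ℂ] F.Elem := (π 1).comp L.symm.toContinuousLinearMap
  let I : F.Elem →L[ℂ] (F.derivedOn ψ 2).Elem := L.toContinuousLinearMap.comp (ι 0)
  -- `R g` is the tuple `(-T g, g)`: a right inverse of `Q` corrected to lie in the kernel of `P`.
  let R : F.Elem →L[ℂ] (F.derivedOn ψ 2).Elem :=
    L.toContinuousLinearMap.comp (ι 1 - (ι 0).comp T)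
  have hP : ∀ a, P (L a) = a 0 + T (a 1) := fun a => by
    change (L.symm (L a)) 0 + T ((L.symm (L a)) 1) = _
    rw [L.symm_apply_apply]
  have hQ : ∀ a, Q (L a) = a 1 := fun a => by
    change (L.symm (L a)) 1 = _
    rw [L.symm_apply_apply]
  have hI : ∀ f, I f = L (Pi.single 0 f) := fun f => rfl
  have hR : ∀ g, R g = L (Pi.single 1 g - Pi.single 0 (T g)) := fun g => rfl
  have hT : ∀ H, (F.derivedOn ψ 2).jet z m H = 0 ↔
      F.jet z (m + 1) (P H) = 0 ∧ F.jet z (m - 1) (Q H) = 0 := fun H => by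
    obtain ⟨a, rfl⟩ := L.surjective H
    rw [F.jet_derivedOn_eq_zero ψ z 2 m a _ (hL a), F.jet_eq_zero_iff_pull ψ,
      F.jet_eq_zero_iff_pull ψ, hP, hQ]
    let c : Fin 2 → ℕ → V := fun l j =>
      (Hol.taylor j (ψ.pull (F.incl (a l)))).1 (ψ.symm.toEquiv z)
    -- Here `q = -t a_1`: the sign turns `a_0' + a_1` into the form `(k+1) p_{k+1} - q_{k+1}`, and
    -- the shift makes `q 0 = 0`.
    have key := elimination hm (c 0) (fun j => if j = 0 then 0 else -c 1 (j - 1)) rfl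
    have e₁ : (∀ k : Fin 2, ∀ i < m, (Hol.taylor i (Hol.comp k
        (assemble 2 fun l => ψ.pull (F.incl (a l))))).1 (ψ.symm.toEquiv z) = 0) ↔
        ∀ k < m, c 0 k = 0 ∧ ((k : ℂ) + 1) • c 0 (k + 1) -
          (if k + 1 = 0 then 0 else -c 1 (k + 1 - 1)) = 0 := by
      have h₀ : ∀ i, (Hol.taylor i (Hol.comp (0 : Fin 2)
          (assemble 2 fun l => ψ.pull (F.incl (a l))))).1 (ψ.symm.toEquiv z) = c 0 i := fun i => by
        rw [comp_zero_assemble]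
      have h₁ : ∀ i, (Hol.taylor i (Hol.comp (1 : Fin 2)
          (assemble 2 fun l => ψ.pull (F.incl (a l))))).1 (ψ.symm.toEquiv z) =
          ((i : ℂ) + 1) • c 0 (i + 1) - (if i + 1 = 0 then 0 else -c 1 (i + 1 - 1)) := fun i => by
        have hi : (i.factorial : ℂ) ≠ 0 := Nat.cast_ne_zero.2 i.factorial_ne_zero
        rw [taylor_comp_assemble, Fin.sum_univ_two]
        simp [c, Nat.factorial_succ, hi]
      rw [Fin.forall_fin_two]
      simp only [h₀, h₁]
      exact ⟨fun h k hk => ⟨h.1 k hk, h.2 k hk⟩,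
        fun h => ⟨fun k hk => (h k hk).1, fun k hk => (h k hk).2⟩⟩
    have e₂ : ∀ j, (Hol.taylor j (ψ.pull (F.incl (a 0 + T (a 1))))).1 (ψ.symm.toEquiv z) =
        c 0 j - (m : ℂ)⁻¹ • (if j = 0 then 0 else -c 1 (j - 1)) := fun j => by
      have hT : F.incl (a 0 + T (a 1)) = F.incl (a 0) + (m : ℂ)⁻¹ • F.incl (M (a 1)) := rfl
      rw [hT, map_add, map_smul, hM, map_add, map_smul, Hol.add_val, Hol.smul_val]
      rcases j with _ | j
      · rw [Hol.taylor_zero_coord_mul]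
        simp [c]
      · rw [Hol.taylor_succ_coord_mul]
        simp [c]
    rw [e₁, key]
    simp only [e₂]
    simp [c]
  obtain ⟨J, hJ⟩ := QuotientRange.exists_equiv_prod (T := (F.derivedOn ψ 2).jet z m)
    (T₁ := F.jet z (m + 1)) (T₂ := F.jet z (m - 1)) P Q I R hT
    (fun g => by simp [hI, hP]) (fun g => by simp [hI, hQ]) (fun g => by simp [hR, hP])
    (fun g => by simp [hR, hQ])
  refine ⟨J, fun f H hH => ?_⟩
  rw [← hJ]
  congr 2
  -- Assembling `(f ∘ ψ, 0)` gives the tuple of `f ∘ ψ` and its derivative, which is also the chain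
  -- transform of `H`. Hence `H = I f`.
  refine (F.derivedOn ψ 2).incl_injective (chain_injective ψ 2 ?_)
  rw [hI, hL, hH, chain_tuple_taylor]
  refine Hol.ext_comp fun k => ?_
  rw [comp_assemble, Hol.comp_tuple]
  fin_cases k <;> simp

/-- Each application of `M` multiplies by `u - w` on the disc and thus shifts the Taylor
coefficients at `w` by one. -/
theorem taylor_pow_apply (F : FunSpace U V) (ψ : ConformalEquiv disc U) (w : disc)
    (M : F.Elem →L[ℂ] F.Elem)
    (hM : ∀ f, ψ.pull (F.incl (M f)) = Hol.mul (Hol.coord w) (ψ.pull (F.incl f)))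
    (l j : ℕ) (f : F.Elem) :
    (Hol.taylor j (ψ.pull (F.incl ((M ^ l) f)))).1 w =
      if l ≤ j then (Hol.taylor (j - l) (ψ.pull (F.incl f))).1 w else 0 := by
  have h : ψ.pull (F.incl ((M ^ l) f)) =
      (Hol.mul (Hol.coord w))^[l] (ψ.pull (F.incl f)) := by
    induction l with
    | zero => rfl
    | succ l ih => rw [pow_succ', Function.iterate_succ_apply', ← ih, ← hM]; rfl
  rw [h, Hol.taylor_coord_mul_iterate]

/-- The kernel of `(τ_{(2,0]})_z` on the space attached to `F`, in terms of two elements of `F`. -/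
theorem jet_two_kernel (F : FunSpace U V) (ψ : ConformalEquiv disc U) (w : disc)
    (M : F.Elem →L[ℂ] F.Elem)
    (hM : ∀ f, ψ.pull (F.incl (M f)) = Hol.mul (Hol.coord w) (ψ.pull (F.incl f)))
    {m : ℕ} (hm : 1 ≤ m) (a : Fin m → F.Elem) :
    (∀ k : Fin m, ∀ i < 2, (Hol.taylor i (Hol.comp k
      (assemble m fun l => ψ.pull (F.incl (a l))))).1 w = 0) ↔
    (∀ j < m + 1, (Hol.taylor j (ψ.pull (F.incl
      (∑ l : Fin m, (1 - (m : ℂ)⁻¹ * (l : ℕ)) • (M ^ (l : ℕ)) (a l))))).1 w = 0) ∧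
    ∀ j < m - 1, (Hol.taylor j (ψ.pull (F.incl
      (∑ l : Fin m, ((l : ℕ) : ℂ) • (M ^ ((l : ℕ) - 1)) (a l))))).1 w = 0 := by
  let c : Fin m → ℕ → V := fun l j =>
    (Hol.taylor j (ψ.pull (F.incl (a l)))).1 w
  -- These are the Taylor coefficients at `w` of `∑ t^l a_l` and `∑ l t^l a_l`.
  let p : ℕ → V := fun j => ∑ l : Fin m, if (l : ℕ) ≤ j then c l (j - l) else 0
  let q : ℕ → V := fun j => ∑ l : Fin m, ((l : ℕ) : ℂ) • if (l : ℕ) ≤ j then c l (j - l) else 0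
  have hq : q 0 = 0 := Finset.sum_eq_zero fun l _ => by
    rcases Nat.eq_zero_or_pos l with h | h
    · simp [h]
    · rw [if_neg (by omega), smul_zero]
  have hval : ∀ (s : Fin m → ℂ) (g : Fin m → F.Elem) (j : ℕ),
      (Hol.taylor j (ψ.pull (F.incl (∑ l, s l • g l)))).1 w =
        ∑ l, s l • (Hol.taylor j (ψ.pull (F.incl (g l)))).1 w :=
    fun s g j => by
      simp only [map_sum, map_smul, Hol.sum_val, Hol.smul_val]
  have e₁ : ∀ j, (Hol.taylor j (ψ.pull (F.incl (
      ∑ l : Fin m, (1 - (m : ℂ)⁻¹ * (l : ℕ)) • (M ^ (l : ℕ)) (a l))))).1 w =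
      p j - (m : ℂ)⁻¹ • q j := fun j => by
    rw [hval, Finset.smul_sum, ← Finset.sum_sub_distrib]
    refine Finset.sum_congr rfl fun l _ => ?_
    rw [taylor_pow_apply F ψ w M hM, sub_smul, one_smul, mul_smul]
  have e₂ : ∀ j, (Hol.taylor j (ψ.pull (F.incl (
      ∑ l : Fin m, ((l : ℕ) : ℂ) • (M ^ ((l : ℕ) - 1)) (a l))))).1 w =
      q (j + 1) := fun j => by
    rw [hval]
    refine Finset.sum_congr rfl fun l _ => ?_
    rw [taylor_pow_apply F ψ w M hM]
    -- Dividing `l t^l` by `t` is legitimate even for `l = 0`: the truncated exponent `l - 1` is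
    -- then multiplied by the weight `0`.
    rcases Nat.eq_zero_or_pos l with h | h
    · simp [h]
    · have h' : j - ((l : ℕ) - 1) = j + 1 - l := by omega
      simp only [h', show (l : ℕ) - 1 ≤ j ↔ (l : ℕ) ≤ j + 1 by omega, c]
  have e₃ : ∀ k : Fin m, (Hol.taylor 0 (Hol.comp k
      (assemble m fun l => ψ.pull (F.incl (a l))))).1 w = p k := fun k => by
    rw [taylor_comp_assemble]
    refine Finset.sum_congr rfl fun l _ => ?_
    have : (((k : ℕ) - l).factorial : ℂ) ≠ 0 := Nat.cast_ne_zero.2 (Nat.factorial_ne_zero _)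
    simp [this, c]
  have e₄ : ∀ k : Fin m, (Hol.taylor 1 (Hol.comp k
      (assemble m fun l => ψ.pull (F.incl (a l))))).1 w =
      (((k : ℕ) : ℂ) + 1) • p (k + 1) - q (k + 1) := fun k => by
    rw [taylor_comp_assemble, Finset.smul_sum, ← Finset.sum_sub_distrib]
    refine Finset.sum_congr rfl fun l _ => ?_
    rw [← sub_smul]
    -- The derivative produces the weight `k + 1 - l`. It vanishes at `l = k + 1`, the one index
    -- occurring in `p (k + 1)` and `q (k + 1)` but not in component `k`.
    rcases lt_trichotomy (l : ℕ) (k + 1) with h | h | h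
    · have hl : (l : ℕ) ≤ k := by omega
      have hf : (((k : ℕ) - l).factorial : ℂ) ≠ 0 := Nat.cast_ne_zero.2 (Nat.factorial_ne_zero _)
      rw [if_pos hl, if_pos h.le, show (k : ℕ) + 1 - l = 1 + (k - l) by omega,
        show 1 + ((k : ℕ) - l) = (k - l) + 1 by omega, Nat.factorial_succ]
      congr 1
      push_cast [Nat.cast_sub hl]
      field_simp
      simp
      ring
    · rw [if_neg (by omega), h]
      simp
    · rw [if_neg (by omega), if_neg (by omega), smul_zero]
  simp only [e₁, e₂, ← elimination hm p q hq]
  refine ⟨fun h k hk => ⟨?_, ?_⟩, fun h k i hi => ?_⟩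
  · exact (e₃ ⟨k, hk⟩).symm.trans (h ⟨k, hk⟩ 0 (by omega))
  · exact (e₄ ⟨k, hk⟩).symm.trans (h ⟨k, hk⟩ 1 (by omega))
  · interval_cases i
    · exact (e₃ k).trans (h k k.2).1
    · exact (e₄ k).trans (h k k.2).2

/-- The splitting is induced by `P = ∑ (1 - l/m) M^l a_l` and `Q = ∑ l M^{l-1} a_l`, whose joint jet
condition is the kernel computed in `jet_two_kernel`. -/
theorem exists_equiv_prod_jet_two (F : FunSpace U V) (hF : F.IsAcceptable)
    (ψ : ConformalEquiv disc U) (m : ℕ) (hm : 1 ≤ m) (z : U) :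
    Nonempty (F.Iterated ψ z m 2 ≃L[ℂ] F.RochbergSpace z (m + 1) × F.RochbergSpace z (m - 1)) := by
  obtain ⟨M, hM⟩ := hF.exists_coord_mul ψ (ψ.symm.toEquiv z : disc)
  obtain ⟨L, hL⟩ := F.exists_equiv_derivedOn ψ m
  let π : Fin m → (Fin m → F.Elem) →L[ℂ] F.Elem := fun i =>
    ContinuousLinearMap.proj (R := ℂ) (φ := fun _ : Fin m => F.Elem) i
  let ι : Fin m → F.Elem →L[ℂ] (Fin m → F.Elem) := fun i =>
    ContinuousLinearMap.single ℂ (fun _ : Fin m => F.Elem) i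
  let P : (F.derivedOn ψ m).Elem →L[ℂ] F.Elem :=
    (∑ l : Fin m, (1 - (m : ℂ)⁻¹ * (l : ℕ)) • (M ^ (l : ℕ)).comp (π l)).comp
      L.symm.toContinuousLinearMap
  let Q : (F.derivedOn ψ m).Elem →L[ℂ] F.Elem :=
    (∑ l : Fin m, ((l : ℕ) : ℂ) • (M ^ ((l : ℕ) - 1)).comp (π l)).comp
      L.symm.toContinuousLinearMap
  have hP : ∀ a, P (L a) = ∑ l : Fin m, (1 - (m : ℂ)⁻¹ * (l : ℕ)) • (M ^ (l : ℕ)) (a l) :=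
    fun a => by
      simp only [P, π, ContinuousLinearMap.comp_apply, sum_apply,
        smul_apply, ContinuousLinearMap.proj_apply,
        ContinuousLinearEquiv.coe_coe, L.symm_apply_apply]
  have hQ : ∀ a, Q (L a) = ∑ l : Fin m, ((l : ℕ) : ℂ) • (M ^ ((l : ℕ) - 1)) (a l) :=
    fun a => by
      simp only [Q, π, ContinuousLinearMap.comp_apply, sum_apply,
        smul_apply, ContinuousLinearMap.proj_apply,
        ContinuousLinearEquiv.coe_coe, L.symm_apply_apply]
  let e : Fin m → F.Elem →L[ℂ] (F.derivedOn ψ m).Elem := fun l =>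
    L.toContinuousLinearMap.comp (ι l)
  have he : ∀ l f, e l f = L (Pi.single l f) := fun _ _ => rfl
  have hPs : ∀ l f, P (e l f) =
      (1 - (m : ℂ)⁻¹ * (l : ℕ)) • (M ^ (l : ℕ)) f := fun l f => by
    rw [he, hP, Finset.sum_eq_single l (fun k _ hk => by rw [Pi.single_eq_of_ne hk]; simp)
      (fun h => absurd (Finset.mem_univ l) h), Pi.single_eq_same]
  have hQs : ∀ l f, Q (e l f) = ((l : ℕ) : ℂ) • (M ^ ((l : ℕ) - 1)) f := fun l f => by
    rw [he, hQ, Finset.sum_eq_single l (fun k _ hk => by rw [Pi.single_eq_of_ne hk]; simp)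
      (fun h => absurd (Finset.mem_univ l) h), Pi.single_eq_same]
  have hT : ∀ H, (F.derivedOn ψ m).jet z 2 H = 0 ↔
      F.jet z (m + 1) (P H) = 0 ∧ F.jet z (m - 1) (Q H) = 0 := fun H => by
    obtain ⟨a, rfl⟩ := L.surjective H
    rw [F.jet_derivedOn_eq_zero ψ z m 2 a _ (hL a), F.jet_eq_zero_iff_pull ψ,
      F.jet_eq_zero_iff_pull ψ, hP, hQ]
    exact jet_two_kernel F ψ _ M hM hm a
  clear_value P Q e
  -- For `m = 1` the operator `Q` is zero and has no right inverse on `F`, but the second jet space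
  -- is zero; hence the requirement only modulo the kernel of the jet.
  obtain ⟨R, hPR, hQR⟩ : ∃ R : F.Elem →L[ℂ] (F.derivedOn ψ m).Elem,
      (∀ g, P (R g) = 0) ∧ ∀ g, F.jet z (m - 1) (Q (R g) - g) = 0 := by
    rcases hm.eq_or_lt with rfl | h2
    · exact ⟨0, fun g => by simp, fun g => funext fun i => i.elim0⟩
    -- `Q` takes `g` in slot `1` to `g` and ignores slot `0`. `P` takes it to `(1 - m⁻¹) M g`, which
    -- slot `0` cancels.
    · refine ⟨e ⟨1, h2⟩ - (e ⟨0, hm⟩).comp ((1 - (m : ℂ)⁻¹) • M), fun g => ?_, fun g => ?_⟩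
      · rw [sub_apply, ContinuousLinearMap.comp_apply, map_sub P, hPs, hPs, smul_apply]
        simp only [Nat.cast_one, mul_one, pow_one, Nat.cast_zero, mul_zero, sub_zero, one_smul,
          pow_zero, one_apply_eq_self, sub_self]
      · rw [sub_apply, ContinuousLinearMap.comp_apply, map_sub Q, hQs, hQs]
        simp only [Nat.cast_one, one_smul, pow_zero, Nat.cast_zero, zero_smul, sub_zero,
          Nat.sub_self, one_apply_eq_self, sub_self, map_zero]
  obtain ⟨J, -⟩ := QuotientRange.exists_equiv_prod (T := (F.derivedOn ψ m).jet z 2)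
    (T₁ := F.jet z (m + 1)) (T₂ := F.jet z (m - 1)) P Q (e ⟨0, hm⟩) R hT
    (fun g => (hPs ⟨0, hm⟩ g).trans (by simp)) (fun g => (hQs ⟨0, hm⟩ g).trans (by simp)) hPR hQR
  exact ⟨J⟩

/-- The jets of the pairs `(f, f')` with `f ∈ F` belong to `F[2,m]`. -/
theorem FunSpace.exists_incl_eq_tuple_taylor (F : FunSpace U V) (ψ : ConformalEquiv disc U)
    (f : F.Elem) :
    ∃ H : (F.derivedOn ψ 2).Elem,
      (F.derivedOn ψ 2).incl H = Hol.tuple fun i : Fin 2 => Hol.taylor i (F.incl f) := by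
  obtain ⟨L, hL⟩ := F.exists_equiv_derivedOn ψ 2
  refine ⟨L (Pi.single 0 f), chain_injective ψ 2 ?_⟩
  rw [hL, chain_tuple_taylor]
  refine Hol.ext_comp fun k => ?_
  rw [comp_assemble, Hol.comp_tuple]
  fin_cases k <;> simp

/-- The matrix of binomial coefficients comes from `τ_i τ_j = ((i+j)!/(i! j!)) τ_{i+j}`. -/
theorem jet_tuple_taylor (F : FunSpace U V) (ψ : ConformalEquiv disc U) (z : U) (m : ℕ)
    (hk : 2 + m = m + 1 + 1) (f : F.Elem) (H : (F.derivedOn ψ 2).Elem)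
    (hH : (F.derivedOn ψ 2).incl H = Hol.tuple fun i : Fin 2 => Hol.taylor i (F.incl f)) :
    (F.derivedOn ψ 2).jet z m H = matrixE 2 m (m + 1) hk (F.jet z (m + 1) f) := by
  funext i j
  change (Hol.taylor (i : ℕ) ((F.derivedOn ψ 2).incl H)).1 z j =
    (((i + j : ℕ).factorial : ℂ) / ((i : ℕ).factorial * (j : ℕ).factorial)) •
      (Hol.taylor ((i : ℕ) + j) (F.incl f)).1 z
  rw [hH, ← Hol.comp_val, ← Hol.taylor_comp, Hol.comp_tuple, Hol.taylor_taylor]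
  rfl

end Splitting

end Rochberg

end

theorem mainTheorem10 {U : TopologicalSpace.Opens ℂ}
    {S : Type*} [NormedAddCommGroup S] [NormedSpace ℂ S] [CompleteSpace S]
    (F : Rochberg.FunSpace U S) (hF : F.IsAcceptable)
    (ψ ψ' : Rochberg.ConformalEquiv Rochberg.disc U)
    (m : ℕ) (hm : 1 ≤ m) (z : U) :
    (∃ E : F.RochbergSpace z (m + 1) →L[ℂ] F.Iterated ψ z 2 m,
      (∀ x, (E x).val = Rochberg.matrixE 2 m (m + 1) (by omega) x.val) ∧
      Topology.IsEmbedding E ∧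
      E.range.ClosedComplemented ∧
      Nonempty ((F.Iterated ψ z 2 m ⧸ E.range) ≃L[ℂ] F.RochbergSpace z (m - 1))) ∧
    Nonempty (F.Iterated ψ z 2 m ≃L[ℂ] F.Iterated ψ' z m 2) := by
  obtain ⟨J, hJ⟩ := Rochberg.exists_equiv_prod_two F hF ψ m hm z
  obtain ⟨J'⟩ := Rochberg.exists_equiv_prod_jet_two F hF ψ' m hm z
  -- Defined as the first summand of the splitting, `E` is bounded, an embedding and complemented at
  -- once; only its formula remains, and it is checked on the functions `(f', f)`.
  let E : F.RochbergSpace z (m + 1) →L[ℂ] F.Iterated ψ z 2 m :=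
    J.symm.toContinuousLinearMap.comp (ContinuousLinearMap.inl ℂ _ _)
  refine ⟨⟨E, fun x => ?_, Rochberg.embedding_complemented_of_equiv_prod J E fun y =>
    J.apply_symm_apply _⟩, ⟨J.trans J'.symm⟩⟩
  obtain ⟨f, rfl⟩ := Rochberg.QuotientRange.mk_surjective _ x
  obtain ⟨H, hH⟩ := F.exists_incl_eq_tuple_taylor ψ f
  have hE : E (Rochberg.QuotientRange.mk _ f) = Rochberg.QuotientRange.mk _ H :=
    J.injective ((J.apply_symm_apply _).trans (hJ f H hH).symm)
  rw [hE, Rochberg.QuotientRange.val_mk, Rochberg.QuotientRange.val_mk]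
  exact Rochberg.jet_tuple_taylor F ψ z m _ f H hH
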